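/- Let $k$ be an algebraically closed field of characteristic zero and $\mathcal C$ a fusion category over $k$ (for example, a modular fusion category), and let $A,A',A''$ be Frobenius algebras in $\mathcal C$ with $\mu\circ\Delta=\mathrm{id}$ (for example, simple special symmetric Frobenius algebras). Let $\mathrm{mod}\text{-}A$ be the category of right $A$-modules, a left module category over $\mathcal C$ via $c\odot M=c\otimes M$. For module categories $\mathcal M,\mathcal N$ over $\mathcal C$ write $\underline{\mathrm{Hom}}(m,m')\in\mathcal C$ for the internal Hom, i.e. the object representing $c\mapsto \mathrm{Hom}(c\odot m,m')$; write $\underline{\mu}:\underline{\mathrm{Hom}}(m',m'')\otimes\underline{\mathrm{Hom}}(m,m')\to\underline{\mathrm{Hom}}(m,m'')$ for the composition of internal Homs and, for a module functor $G$, $\underline{G}:\underline{\mathrm{Hom}}(m,m')\to\underline{\mathrm{Hom}}(Gm,Gm')$ for the induced morphism. For $\mathcal C$-module functors $F,F':\mathcal M\to\mathcal N$ let $\underline{\mathrm{Nat}}(F,F')=\int_{m}\underline{\mathrm{Hom}}(Fm,F'm)$ with dinatural structure morphisms $j_m$. It is regarded as an object of the Drinfeld center $\mathcal Z(\mathcal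 C)$ with the half-braiding $c_{\underline{\mathrm{Nat}}(F,F');-}$ for which the morphisms $\mathrm{ev}\circ(j_m\odot\mathrm{id}):\underline{\mathrm{Nat}}(F,F')\odot Fm\to F'm$ form a module natural transformation. For an $A$-$B$-bimodule $X$ let $G^X=-\otimes_A X:\mathrm{mod}\text{-}A\to\mathrm{mod}\text{-}B$, a $\mathcal C$-module functor, and for $A$-$B$-bimodules $X,Y$ let $$\mathbb D^{X,Y}=\underline{\mathrm{Nat}}(G^X,G^Y)\in\mathcal Z(\mathcal C)$$ be the object of defect fields. Let $X_1,X_3$ be $A$-$A'$-bimodules and $X_2,X_4$ be $A'$-$A''$-bimodules, and put $G_i=G^{X_i}$. Using the canonical isomorphisms of module functors $G_2\circ G_1\cong G^{X_1\otimes_{A'}X_2}$ and $G_4\circ G_3\cong G^{X_3\otimes_{A'}X_4}$, identify $\underline{\mathrm{Nat}}(G_2G_1,G_4G_3)$ with $\mathbb D^{X_1\otimes_{A'}X_2,\,X_3\otimes_{A'}X_4}$. The left and right horizontal operator products $$\mu_{\rm hor}^{\rm left}:\mathbb D^{X_2,X_4}\otimes\mathbb D^{X_1,X_3}\to\mathbb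 D^{X_1\otimes_{A'}X_2,X_3\otimes_{A'}X_4},\qquad \mu_{\rm hor}^{\rm right}:\mathbb D^{X_1,X_3}\otimes\mathbb D^{X_2,X_4}\to\mathbb D^{X_1\otimes_{A'}X_2,X_3\otimes_{A'}X_4}$$ are the morphisms in $\mathcal Z(\mathcal C)$ induced, through the universal property of the end, by the dinatural families (for $M\in\mathrm{mod}\text{-}A$) $$\underline{\mu}\circ(\mathrm{id}\otimes\underline{G_2})\circ(j^{G_2,G_4}_{G_3M}\otimes j^{G_1,G_3}_M)\qquad\text{and}\qquad \underline{\mu}\circ(\underline{G_4}\otimes\mathrm{id})\circ(j^{G_1,G_3}_M\otimes j^{G_2,G_4}_{G_1M}),$$ respectively. Then the two products differ by a half-braiding: $$\mu_{\rm hor}^{\rm left}=\mu_{\rm hor}^{\rm right}\circ c_{\mathbb D^{X_2,X_4};\,\mathbb D^{X_1,X_3}}\, ,$$ where $c_{\mathbb D^{X_2,X_4};\,\mathbb D^{X_1,X_3}}:\mathbb D^{X_2,X_4}\otimes\mathbb D^{X_1,X_3}\to\mathbb D^{X_1,X_3}\otimes\mathbb D^{X_2,X_4}$ is the half-braiding of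 $\mathbb D^{X_2,X_4}$. -/

import Mathlib

open CategoryTheory MonoidalCategory Limits

namespace DefectFields

universe v u v₁ u₁ v₂ u₂ v₃ u₃ w

section InternalHoms

open scoped MonoidalLeftAction

variable {C : Type u} [Category.{v} C] [MonoidalCategory C]
variable {M : Type u₁} [Category.{v₁} M] [MonoidalLeftAction C M]

variable (C) in
/-- An internal Hom of two objects of a module category `M` over `C`: an object of `C` that
represents the functor `c ↦ (c ⊙ₗ m ⟶ m')`, with universal element `ev`. -/
structure InternalHom (m m' : M) where
  obj : C
  ev : obj ⊙ₗ m ⟶ m'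
  exists_unique : ∀ (c : C) (f : c ⊙ₗ m ⟶ m'), ∃! g : c ⟶ obj, g ⊵ₗ m ≫ ev = f

variable (C M) in
/-- All internal Homs of the module category `M` exist. -/
class HasInternalHoms : Prop where
  nonempty : ∀ m m' : M, Nonempty (InternalHom C m m')

variable [HasInternalHoms C M]

variable (C) in
/-- The internal Hom `iHom(m, m')` in `C`. -/
noncomputable def iHom (m m' : M) : C :=
  (Classical.choice (HasInternalHoms.nonempty (C := C) m m')).obj

variable (C) in
/-- The evaluation `iHom(m, m') ⊙ m ⟶ m'`. -/
noncomputable def iEv (m m' : M) : iHom C m m' ⊙ₗ m ⟶ m' :=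
  (Classical.choice (HasInternalHoms.nonempty (C := C) m m')).ev

theorem iHom_exists_unique {m m' : M} {c : C} (f : c ⊙ₗ m ⟶ m') :
    ∃! g : c ⟶ iHom C m m', g ⊵ₗ m ≫ iEv C m m' = f :=
  (Classical.choice (HasInternalHoms.nonempty (C := C) m m')).exists_unique c f

/-- The morphism `c ⟶ iHom(m, m')` that corresponds to `f : c ⊙ m ⟶ m'`. -/
noncomputable def iCurry {m m' : M} {c : C} (f : c ⊙ₗ m ⟶ m') : c ⟶ iHom C m m' :=
  (iHom_exists_unique f).choose

@[simp]
theorem iCurry_ev {m m' : M} {c : C} (f : c ⊙ₗ m ⟶ m') :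
    iCurry f ⊵ₗ m ≫ iEv C m m' = f :=
  (iHom_exists_unique f).choose_spec.1

@[simp]
theorem iCurry_ev_assoc {c : C} {m m' : M} (f : c ⊙ₗ m ⟶ m') {Z : M} (h : m' ⟶ Z) :
    iCurry (C := C) f ⊵ₗ m ≫ iEv C m m' ≫ h = f ≫ h := by
  rw [← Category.assoc, iCurry_ev]

theorem iHom_ext {m m' : M} {c : C} {g g' : c ⟶ iHom C m m'}
    (h : g ⊵ₗ m ≫ iEv C m m' = g' ⊵ₗ m ≫ iEv C m m') : g = g' :=
  (iHom_exists_unique (g' ⊵ₗ m ≫ iEv C m m')).unique h rfl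

variable (C) in
/-- Covariant functoriality of `iHom` in its second argument. -/
noncomputable def iHomPost (m : M) {n n' : M} (f : n ⟶ n') : iHom C m n ⟶ iHom C m n' :=
  iCurry (iEv C m n ≫ f)

variable (C) in
/-- Contravariant functoriality of `iHom` in its first argument. -/
noncomputable def iHomPre {m m' : M} (f : m ⟶ m') (n : M) : iHom C m' n ⟶ iHom C m n :=
  iCurry (iHom C m' n ⊴ₗ f ≫ iEv C m' n)

variable (C) in
/-- The multiplication `iHom(m', m'') ⊗ iHom(m, m') ⟶ iHom(m, m'')` of internal Homs. -/
noncomputable def iMul (m m' m'' : M) :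
    iHom C m' m'' ⊗ iHom C m m' ⟶ iHom C m m'' :=
  iCurry ((MonoidalLeftAction.actionAssocIso _ _ m).hom ≫
    iHom C m' m'' ⊴ₗ iEv C m m' ≫ iEv C m' m'')

variable {N : Type u₂} [Category.{v₂} N] [MonoidalLeftAction C N] [HasInternalHoms C N]

variable (C) in
/-- The morphism `iHom(m, m') ⟶ iHom(G m, G m')` induced by a module functor `G`. -/
noncomputable def iFun (G : M ⥤ N) [G.LeftLinear C] (m m' : M) :
    iHom C m m' ⟶ iHom C (G.obj m) (G.obj m') :=
  iCurry (Functor.LaxLeftLinear.μₗ G _ m ≫ G.map (iEv C m m'))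

theorem iHomPost_ev (m : M) {n n' : M} (f : n ⟶ n') :
    iHomPost C m f ⊵ₗ m ≫ iEv C m n' = iEv C m n ≫ f := iCurry_ev _

theorem iHomPre_ev {m m' : M} (f : m ⟶ m') (n : M) :
    iHomPre C f n ⊵ₗ m ≫ iEv C m n = iHom C m' n ⊴ₗ f ≫ iEv C m' n := iCurry_ev _

theorem iMul_ev (m m' m'' : M) :
    iMul C m m' m'' ⊵ₗ m ≫ iEv C m m'' = (MonoidalLeftAction.actionAssocIso _ _ m).hom ≫
      iHom C m' m'' ⊴ₗ iEv C m m' ≫ iEv C m' m'' := iCurry_ev _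

theorem iFun_ev (G : M ⥤ N) [G.LeftLinear C] (m m' : M) :
    iFun C G m m' ⊵ₗ G.obj m ≫ iEv C _ _ =
      Functor.LaxLeftLinear.μₗ G _ m ≫ G.map (iEv C m m') := iCurry_ev _

end InternalHoms

section InternalNats

open scoped MonoidalLeftAction
open Functor.LaxLeftLinear Functor.OplaxLeftLinear MonoidalLeftAction

variable {C : Type u} [Category.{v} C] [MonoidalCategory C]
variable {M : Type u₁} [Category.{v₁} M] [MonoidalLeftAction C M]
variable {N : Type u₂} [Category.{v₂} N] [MonoidalLeftAction C N]
variable {L : Type u₃} [Category.{v₃} L] [MonoidalLeftAction C L]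

/-- Naturality in `m` of a family `c ⊙ F m ⟶ F' m`. -/
def IsNatFam (c : C) (F F' : M ⥤ N) (φ : ∀ m, c ⊙ₗ F.obj m ⟶ F'.obj m) : Prop :=
  ∀ ⦃m m' : M⦄ (f : m ⟶ m'), c ⊴ₗ F.map f ≫ φ m' = φ m ≫ F'.map f

/-- A family `Z ⊙ F m ⟶ F' m`, for `Z` in the Drinfeld center, respects the module structures,
where `Z ⊙ F` is a module functor through the half-braiding of `Z`. -/
def IsModFam (Z : Center C) (F F' : M ⥤ N) [F.LeftLinear C] [F'.LeftLinear C]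
    (φ : ∀ m, Z.1 ⊙ₗ F.obj m ⟶ F'.obj m) : Prop :=
  ∀ (c : C) (m : M), Z.1 ⊴ₗ μₗ F c m ≫ φ (c ⊙ₗ m) =
    (αₗ Z.1 c (F.obj m)).inv ≫ (Z.2.β c).hom ⊵ₗ F.obj m ≫ (αₗ c Z.1 (F.obj m)).hom ≫
      c ⊴ₗ φ m ≫ μₗ F' c m

variable [HasInternalHoms C N]

/-- Dinaturality of a family of morphisms `c ⟶ iHom(F m, F' m)`. -/
def IsDinat (c : C) (F F' : M ⥤ N) (φ : ∀ m, c ⟶ iHom C (F.obj m) (F'.obj m)) : Prop :=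
  ∀ ⦃m m' : M⦄ (f : m ⟶ m'),
    φ m ≫ iHomPost C (F.obj m) (F'.map f) = φ m' ≫ iHomPre C (F.map f) (F'.obj m')

theorem isDinat_iff {c : C} {F F' : M ⥤ N} (φ : ∀ m, c ⟶ iHom C (F.obj m) (F'.obj m)) :
    IsDinat c F F' φ ↔ IsNatFam c F F' (fun m => φ m ⊵ₗ F.obj m ≫ iEv C _ _) := by
  refine forall_congr' fun m => forall_congr' fun m' => forall_congr' fun f => ?_
  constructor
  · intro h
    have := congrArg (fun t => t ⊵ₗ F.obj m ≫ iEv C _ _) h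
    simp only [iHomPost, iHomPre, comp_actionHomLeft, Category.assoc, iCurry_ev] at this
    simp only [Category.assoc]
    rw [this, action_exchange_assoc]
  · intro h
    apply iHom_ext
    simp only [iHomPost, iHomPre, comp_actionHomLeft, Category.assoc, iCurry_ev]
    rw [← action_exchange_assoc]
    simpa using h.symm

variable (C) in
/-- An object of internal natural transformations from `F` to `F'`: an end
`∫ m, iHom(F m, F' m)` in `C`, lifted to the Drinfeld center by the half-braiding for which the
evaluations form a module natural transformation. -/
structure InternalNat (F F' : M ⥤ N) [F.LeftLinear C] [F'.LeftLinear C] where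
  obj : Center C
  j : ∀ m, obj.1 ⟶ iHom C (F.obj m) (F'.obj m)
  dinat : IsDinat obj.1 F F' j
  exists_unique : ∀ (c : C) (φ : ∀ m, c ⟶ iHom C (F.obj m) (F'.obj m)), IsDinat c F F' φ →
    ∃! g : c ⟶ obj.1, ∀ m, g ≫ j m = φ m
  isMod : IsModFam obj F F' (fun m => j m ⊵ₗ F.obj m ≫ iEv C _ _)

end InternalNats

section Representing
open scoped MonoidalLeftAction
open Functor.LaxLeftLinear Functor.OplaxLeftLinear MonoidalLeftAction

variable {C : Type u} [Category.{v} C] [MonoidalCategory C]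
variable {M : Type u₁} [Category.{v₁} M] [MonoidalLeftAction C M]
variable {N : Type u₂} [Category.{v₂} N] [MonoidalLeftAction C N]

theorem act_snake₁ (c c' : C) [ExactPairing c c'] (m : M) :
    (λₗ (c ⊙ₗ m : M)).inv ≫ η_ c c' ⊵ₗ (c ⊙ₗ m) ≫ (αₗ c c' (c ⊙ₗ m)).hom ≫
      c ⊴ₗ ((αₗ c' c m).inv ≫ ε_ c c' ⊵ₗ m ≫ (λₗ m).hom) = 𝟙 _ := by
  have h := congrArg (fun t => ((λ_ c).inv ≫ t ≫ (ρ_ c).hom) ⊵ₗ m)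
    (ExactPairing.evaluation_coevaluation c c')
  simp only [comp_actionHomLeft, whiskerLeft_actionHomLeft, whiskerRight_actionHomLeft,
    rightUnitor_actionHom, leftUnitor_actionHom, Category.assoc, Iso.inv_hom_id_assoc,
    Iso.inv_hom_id, Category.comp_id, id_actionHomLeft] at h
  rw [← h]
  have h2 := associator_actionHom c c' c m
  have h3 : (λ_ c).inv ⊵ₗ m = (λₗ (c ⊙ₗ m : M)).inv ≫ (αₗ (𝟙_ C) c m).inv := by
    rw [← cancel_mono ((αₗ (𝟙_ C) c m).hom ≫ (λₗ (c ⊙ₗ m : M)).hom), ← leftUnitor_actionHom,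
      ← comp_actionHomLeft]
    simp
  rw [h3]
  have h4 : (αₗ (c ⊗ c') c m).inv ≫ (α_ c c' c).hom ⊵ₗ m ≫ (αₗ c (c' ⊗ c) m).hom =
      (αₗ c c' (c ⊙ₗ m)).hom ≫ c ⊴ₗ (αₗ c' c m).inv := by
    rw [Iso.inv_comp_eq, ← cancel_mono (c ⊴ₗ (αₗ c' c m).hom)]
    simp only [Category.assoc, h2]
    rw [← actionHomRight_comp]; simp
  simp only [Category.assoc, Iso.inv_hom_id_assoc, actionHomRight_comp, reassoc_of% h4]

theorem act_snake₂ (c c' : C) [ExactPairing c c'] (m : M) :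
    (c' ⊴ₗ ((λₗ m).inv ≫ η_ c c' ⊵ₗ m ≫ (αₗ c c' m).hom)) ≫ (αₗ c' c (c' ⊙ₗ m)).inv ≫
      ε_ c c' ⊵ₗ (c' ⊙ₗ m) ≫ (λₗ (c' ⊙ₗ m : M)).hom = 𝟙 _ := by
  have h := congrArg (fun t => ((ρ_ c').inv ≫ t ≫ (λ_ c').hom) ⊵ₗ m)
    (ExactPairing.coevaluation_evaluation c c')
  simp only [comp_actionHomLeft, whiskerLeft_actionHomLeft, whiskerRight_actionHomLeft,
    rightUnitor_actionHom, leftUnitor_actionHom, Category.assoc, Iso.inv_hom_id_assoc,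
    Iso.inv_hom_id, Category.comp_id, id_actionHomLeft] at h
  rw [← h]
  have h2 := associator_actionHom c' c c' m
  have h3 : (ρ_ c').inv ⊵ₗ m = c' ⊴ₗ (λₗ m).inv ≫ (αₗ c' (𝟙_ C) m).inv := by
    rw [← cancel_mono ((αₗ c' (𝟙_ C) m).hom ≫ c' ⊴ₗ (λₗ m : _ ≅ m).hom),
      ← rightUnitor_actionHom, ← comp_actionHomLeft]
    simp
  rw [h3]
  have h4 : (αₗ c' (c ⊗ c') m).inv ≫ (α_ c' c c').inv ⊵ₗ m ≫ (αₗ (c' ⊗ c) c' m).hom =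
      c' ⊴ₗ (αₗ c c' m).hom ≫ (αₗ c' c (c' ⊙ₗ m)).inv := by
    rw [Iso.inv_comp_eq, ← cancel_epi ((α_ c' c c').hom ⊵ₗ m), reassoc_of% h2,
      ← comp_actionHomLeft_assoc]
    simp
  simp only [Category.assoc, Iso.inv_hom_id_assoc, actionHomRight_comp, reassoc_of% h4]

variable {F F' : M ⥤ N} {E : C} {e : ∀ m, E ⊙ₗ F.obj m ⟶ F'.obj m}

theorem rep_left (huniv : ∀ (c : C) (φ : ∀ m, c ⊙ₗ F.obj m ⟶ F'.obj m), IsNatFam c F F' φ →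
    ∃! g : c ⟶ E, ∀ m, g ⊵ₗ F.obj m ≫ e m = φ m) (c c' d : C) [ExactPairing c c']
    (ψ : ∀ m, d ⊙ₗ F.obj m ⟶ c ⊙ₗ F'.obj m)
    (hψ : ∀ ⦃m m' : M⦄ (f : m ⟶ m'), d ⊴ₗ F.map f ≫ ψ m' = ψ m ≫ c ⊴ₗ F'.map f) :
    ∃ g : d ⟶ c ⊗ E, ∀ m, g ⊵ₗ F.obj m ≫ (αₗ c E (F.obj m)).hom ≫ c ⊴ₗ e m = ψ m := by
  obtain ⟨h, hh, -⟩ := huniv (c' ⊗ d) (fun m => (αₗ c' d _).hom ≫ c' ⊴ₗ ψ m ≫ (αₗ c' c _).inv ≫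
    ε_ c c' ⊵ₗ F'.obj m ≫ (λₗ (F'.obj m)).hom) (by
      intro m m' f
      simp only [tensor_actionHomRight, Category.assoc, Iso.inv_hom_id_assoc,
        Iso.cancel_iso_hom_left]
      rw [← actionHomRight_comp_assoc, hψ, actionHomRight_comp_assoc]
      rw [actionUnitIso_hom_naturality, ← action_exchange_assoc]
      simp)
  refine ⟨(λ_ d).inv ≫ η_ c c' ▷ d ≫ (α_ c c' d).hom ≫ c ◁ h, fun m => ?_⟩
  have h1 := hh m
  simp only [comp_actionHomLeft, whiskerLeft_actionHomLeft, Category.assoc, Iso.inv_hom_id_assoc]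
  rw [← actionHomRight_comp, h1]
  have h3 : (λ_ d).inv ⊵ₗ F.obj m = (λₗ (d ⊙ₗ F.obj m : N)).inv ≫ (αₗ (𝟙_ C) d _).inv := by
    rw [← cancel_mono ((αₗ (𝟙_ C) d _).hom ≫ (λₗ (d ⊙ₗ F.obj m : N)).hom), ← leftUnitor_actionHom,
      ← comp_actionHomLeft]
    simp
  have h5 := act_snake₁ c c' (F'.obj m)
  have h6 : (λₗ (d ⊙ₗ F.obj m)).inv ≫ η_ c c' ⊵ₗ (d ⊙ₗ F.obj m) ≫ (c ⊗ c') ⊴ₗ ψ m =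
      ψ m ≫ (λₗ _).inv ≫ η_ c c' ⊵ₗ _ := by
    rw [← action_exchange, actionUnitIso_inv_naturality_assoc]
  rw [h3]
  simp only [whiskerRight_actionHomLeft, actionHomRight_comp, Category.assoc,
    Iso.inv_hom_id_assoc, associator_actionHom_assoc] at h5 h6 ⊢
  have h7 := congrArg (fun t => t ≫ (αₗ c c' _).hom) h6
  simp only [tensor_actionHomRight, Category.assoc, Iso.inv_hom_id, Category.comp_id] at h7
  rw [reassoc_of% h7, h5, Category.comp_id]

theorem rep_left_ext (huniv : ∀ (c : C) (φ : ∀ m, c ⊙ₗ F.obj m ⟶ F'.obj m), IsNatFam c F F' φ →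
    ∃! g : c ⟶ E, ∀ m, g ⊵ₗ F.obj m ≫ e m = φ m) (hnat : IsNatFam E F F' e)
    (c c' d : C) [ExactPairing c c'] (g g' : d ⟶ c ⊗ E)
    (h : ∀ m, g ⊵ₗ F.obj m ≫ (αₗ c E (F.obj m)).hom ≫ c ⊴ₗ e m =
      g' ⊵ₗ F.obj m ≫ (αₗ c E (F.obj m)).hom ≫ c ⊴ₗ e m) : g = g' := by
  apply (tensorLeftHomEquiv d c c' E).symm.injective
  have key : ∀ g : d ⟶ c ⊗ E, ∀ m, ((tensorLeftHomEquiv d c c' E).symm g) ⊵ₗ F.obj m ≫ e m =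
      (αₗ c' d _).hom ≫ c' ⊴ₗ (g ⊵ₗ F.obj m ≫ (αₗ c E (F.obj m)).hom ≫ c ⊴ₗ e m) ≫
        (αₗ c' c _).inv ≫ ε_ c c' ⊵ₗ F'.obj m ≫ (λₗ (F'.obj m)).hom := by
    intro g m
    have h4 : (αₗ c' (c ⊗ E) (F.obj m)).inv ≫ (α_ c' c E).inv ⊵ₗ F.obj m ≫
        (αₗ (c' ⊗ c) E (F.obj m)).hom =
        c' ⊴ₗ (αₗ c E (F.obj m)).hom ≫ (αₗ c' c (E ⊙ₗ F.obj m)).inv := by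
      have h2 := associator_actionHom c' c E (F.obj m)
      rw [Iso.inv_comp_eq, ← cancel_epi ((α_ c' c E).hom ⊵ₗ F.obj m), reassoc_of% h2,
        ← comp_actionHomLeft_assoc]
      simp
    have h5 : ε_ c c' ⊵ₗ (E ⊙ₗ F.obj m) ≫ (λₗ (E ⊙ₗ F.obj m : N)).hom ≫ e m =
        (αₗ c' c _).hom ≫ c' ⊴ₗ c ⊴ₗ e m ≫ (αₗ c' c _).inv ≫ ε_ c c' ⊵ₗ F'.obj m ≫
          (λₗ (F'.obj m)).hom := by
      rw [actionUnitIso_hom_naturality, ← action_exchange_assoc]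
      simp
    simp only [tensorLeftHomEquiv, Equiv.coe_fn_symm_mk, comp_actionHomLeft,
      whiskerLeft_actionHomLeft, whiskerRight_actionHomLeft, leftUnitor_actionHom,
      Category.assoc, Iso.inv_hom_id_assoc, actionHomRight_comp, h5, reassoc_of% h4]
  exact (huniv _ (fun m => (tensorLeftHomEquiv d c c' E).symm g ⊵ₗ F.obj m ≫ e m) (fun m m' f => by
    rw [action_exchange_assoc, hnat f, Category.assoc])).unique (fun _ => rfl)
      (fun m => by rw [key, key, h])

end Representing

section HB2
open scoped MonoidalLeftAction
open Functor.LaxLeftLinear Functor.OplaxLeftLinear MonoidalLeftAction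

variable {C : Type u} [Category.{v} C] [MonoidalCategory C]
variable {M : Type u₁} [Category.{v₁} M] [MonoidalLeftAction C M]
variable {N : Type u₂} [Category.{v₂} N] [MonoidalLeftAction C N]
variable {F F' : M ⥤ N} [F.LeftLinear C] {E : C} {e : ∀ m, E ⊙ₗ F.obj m ⟶ F'.obj m}

theorem rep_right (huniv : ∀ (c : C) (φ : ∀ m, c ⊙ₗ F.obj m ⟶ F'.obj m), IsNatFam c F F' φ →
    ∃! g : c ⟶ E, ∀ m, g ⊵ₗ F.obj m ≫ e m = φ m) (c' c d : C) [ExactPairing c' c]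
    (ψ : ∀ m, d ⊙ₗ F.obj m ⟶ F'.obj (c ⊙ₗ m))
    (hψ : ∀ ⦃m m' : M⦄ (f : m ⟶ m'), d ⊴ₗ F.map f ≫ ψ m' = ψ m ≫ F'.map (c ⊴ₗ f)) :
    ∃ g : d ⟶ E ⊗ c, ∀ m, g ⊵ₗ F.obj m ≫ (αₗ E c (F.obj m)).hom ≫ E ⊴ₗ μₗ F c m ≫
      e (c ⊙ₗ m) = ψ m := by
  obtain ⟨h, hh, -⟩ := huniv (d ⊗ c') (fun m => (αₗ d c' _).hom ≫ d ⊴ₗ μₗ F c' m ≫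
    ψ (c' ⊙ₗ m) ≫ F'.map ((αₗ c c' m).inv ≫ ε_ c' c ⊵ₗ m ≫ (λₗ m).hom)) (by
      intro m m' f
      simp only [tensor_actionHomRight, Category.assoc, Iso.inv_hom_id_assoc,
        Iso.cancel_iso_hom_left]
      rw [← actionHomRight_comp_assoc, μₗ_naturality_right, actionHomRight_comp_assoc,
        reassoc_of% hψ (c' ⊴ₗ f), ← F'.map_comp, ← F'.map_comp]
      simp only [Category.assoc]
      rw [actionUnitIso_hom_naturality, ← action_exchange_assoc]
      simp)
  refine ⟨(ρ_ d).inv ≫ d ◁ η_ c' c ≫ (α_ d c' c).inv ≫ h ▷ c, fun m => ?_⟩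
  have h1 := hh (c ⊙ₗ m)
  have h3 : (ρ_ d).inv ⊵ₗ F.obj m = d ⊴ₗ (λₗ (F.obj m)).inv ≫ (αₗ d (𝟙_ C) _).inv := by
    rw [← cancel_mono ((αₗ d (𝟙_ C) (F.obj m)).hom ≫ d ⊴ₗ (λₗ (F.obj m) : _ ≅ F.obj m).hom),
      ← rightUnitor_actionHom, ← comp_actionHomLeft]
    simp [-μₗ_unitality, -δₗ_unitality_inv]
  have h4 : (αₗ d (c' ⊗ c) (F.obj m)).inv ≫ (α_ d c' c).inv ⊵ₗ F.obj m ≫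
        (αₗ (d ⊗ c') c (F.obj m)).hom =
        d ⊴ₗ (αₗ c' c (F.obj m)).hom ≫ (αₗ d c' (c ⊙ₗ F.obj m)).inv := by
    have h2 := associator_actionHom d c' c (F.obj m)
    rw [Iso.inv_comp_eq, ← cancel_epi ((α_ d c' c).hom ⊵ₗ F.obj m), reassoc_of% h2,
      ← comp_actionHomLeft_assoc]
    simp
  have h5 : h ⊵ₗ (c ⊙ₗ F.obj m) ≫ E ⊴ₗ μₗ F c m ≫ e (c ⊙ₗ m) =
      (αₗ d c' _).hom ≫ d ⊴ₗ c' ⊴ₗ μₗ F c m ≫ d ⊴ₗ μₗ F c' (c ⊙ₗ m) ≫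
    ψ (c' ⊙ₗ c ⊙ₗ m) ≫ F'.map ((αₗ c c' _).inv ≫ ε_ c' c ⊵ₗ (c ⊙ₗ m) ≫ (λₗ (c ⊙ₗ m)).hom) := by
    rw [← action_exchange_assoc, h1]
    simp
  have h6 : (λₗ (F.obj m)).inv ≫ η_ c' c ⊵ₗ F.obj m ≫ (αₗ c' c (F.obj m)).hom ≫
      c' ⊴ₗ μₗ F c m ≫ μₗ F c' (c ⊙ₗ m) =
      F.map ((λₗ m).inv ≫ η_ c' c ⊵ₗ m ≫ (αₗ c' c m).hom) := by
    rw [← μₗ_associativity, μₗ_naturality_left_assoc, Functor.map_comp, Functor.map_comp]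
    simp
  simp only [comp_actionHomLeft, whiskerLeft_actionHomLeft, whiskerRight_actionHomLeft,
    Category.assoc, Iso.inv_hom_id_assoc, h5, h3, reassoc_of% h4]
  have h7 := congrArg (fun t => d ⊴ₗ t) h6
  simp only [actionHomRight_comp] at h7
  rw [reassoc_of% h7, reassoc_of% hψ, ← F'.map_comp]
  rw [act_snake₂ c' c m]
  simp

theorem rep_right_ext (huniv : ∀ (c : C) (φ : ∀ m, c ⊙ₗ F.obj m ⟶ F'.obj m),
    IsNatFam c F F' φ → ∃! g : c ⟶ E, ∀ m, g ⊵ₗ F.obj m ≫ e m = φ m) (hnat : IsNatFam E F F' e)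
    (c' c d : C) [ExactPairing c' c] (g g' : d ⟶ E ⊗ c)
    (h : ∀ m, g ⊵ₗ F.obj m ≫ (αₗ E c (F.obj m)).hom ≫ E ⊴ₗ μₗ F c m ≫ e (c ⊙ₗ m) =
      g' ⊵ₗ F.obj m ≫ (αₗ E c (F.obj m)).hom ≫ E ⊴ₗ μₗ F c m ≫ e (c ⊙ₗ m)) : g = g' := by
  apply (tensorRightHomEquiv d c' c E).symm.injective
  have key : ∀ g : d ⟶ E ⊗ c, ∀ m, ((tensorRightHomEquiv d c' c E).symm g) ⊵ₗ F.obj m ≫ e m =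
      (αₗ d c' _).hom ≫ d ⊴ₗ μₗ F c' m ≫ (g ⊵ₗ F.obj (c' ⊙ₗ m) ≫ (αₗ E c (F.obj _)).hom ≫
        E ⊴ₗ μₗ F c _ ≫ e (c ⊙ₗ c' ⊙ₗ m)) ≫
          F'.map ((αₗ c c' m).inv ≫ ε_ c' c ⊵ₗ m ≫ (λₗ m).hom) := by
    intro g m
    have h4 : (αₗ (E ⊗ c) c' (F.obj m)).inv ≫ (α_ E c c').hom ⊵ₗ F.obj m ≫
        (αₗ E (c ⊗ c') (F.obj m)).hom =
        (αₗ E c (c' ⊙ₗ F.obj m)).hom ≫ E ⊴ₗ (αₗ c c' (F.obj m)).inv := by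
      have h2 := associator_actionHom E c c' (F.obj m)
      rw [Iso.inv_comp_eq, ← cancel_mono (E ⊴ₗ (αₗ c c' (F.obj m)).hom)]
      simp only [Category.assoc, h2]
      rw [← actionHomRight_comp]; simp
    have h5 : (αₗ c c' (F.obj m)).inv ≫ ε_ c' c ⊵ₗ F.obj m ≫ (λₗ (F.obj m)).hom =
        c ⊴ₗ μₗ F c' m ≫ μₗ F c (c' ⊙ₗ m) ≫
          F.map ((αₗ c c' m).inv ≫ ε_ c' c ⊵ₗ m ≫ (λₗ m).hom) := by
      rw [Functor.map_comp, Functor.map_comp, μₗ_associativity_inv_assoc,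
        ← μₗ_naturality_left_assoc, ← μₗ_unitality]
    have h6 := hnat ((αₗ c c' m).inv ≫ ε_ c' c ⊵ₗ m ≫ (λₗ m).hom)
    have h7 := congrArg (fun t => E ⊴ₗ t) h5
    simp only [actionHomRight_comp] at h7
    simp only [Category.assoc]
    rw [← h6, action_exchange_assoc]
    simp only [tensorRightHomEquiv, Equiv.coe_fn_symm_mk, comp_actionHomLeft,
      whiskerLeft_actionHomLeft, whiskerRight_actionHomLeft, rightUnitor_actionHom,
      Category.assoc, Iso.inv_hom_id_assoc, reassoc_of% h4, reassoc_of% h7,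
      tensor_actionHomRight]
  exact (huniv _ (fun m => (tensorRightHomEquiv d c' c E).symm g ⊵ₗ F.obj m ≫ e m) (fun m m' f => by
    rw [action_exchange_assoc, hnat f, Category.assoc])).unique (fun _ => rfl)
      (fun m => by rw [key, key, h])

end HB2

section HalfBraiding
open scoped MonoidalLeftAction
open Functor Functor.LaxLeftLinear Functor.OplaxLeftLinear MonoidalLeftAction

variable {C : Type u} [Category.{v} C] [MonoidalCategory C]
variable {M : Type u₁} [Category.{v₁} M] [MonoidalLeftAction C M]
variable {N : Type u₂} [Category.{v₂} N] [MonoidalLeftAction C N]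
variable {F F' : M ⥤ N} [F.LeftLinear C] [F'.LeftLinear C]
  {E : C} {e : ∀ m, E ⊙ₗ F.obj m ⟶ F'.obj m}

theorem halfBraiding_of_rep [RigidCategory C] (huniv : ∀ (c : C) (φ : ∀ m, c ⊙ₗ F.obj m ⟶ F'.obj m), IsNatFam c F F' φ →
    ∃! g : c ⟶ E, ∀ m, g ⊵ₗ F.obj m ≫ e m = φ m) (hnat : IsNatFam E F F' e) :
    ∃ B : HalfBraiding E, IsModFam (⟨E, B⟩ : Center C) F F' e := by
  have hb : ∀ c : C, ∃ b : E ⊗ c ⟶ c ⊗ E, ∀ m, b ⊵ₗ F.obj m ≫ (αₗ c E (F.obj m)).hom ≫ c ⊴ₗ e m =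
      (αₗ E c (F.obj m)).hom ≫ E ⊴ₗ μₗ F c m ≫ e (c ⊙ₗ m) ≫ δₗ F' c m := by
    intro c
    refine rep_left huniv c cᘁ (E ⊗ c) _ fun m m' f => ?_
    have := hnat (c ⊴ₗ f)
    simp only [tensor_actionHomRight, Category.assoc, Iso.inv_hom_id_assoc]
    rw [← actionHomRight_comp_assoc, μₗ_naturality_right, actionHomRight_comp_assoc,
      reassoc_of% this, δₗ_naturality_right]
  have hg : ∀ c : C, ∃ b : c ⊗ E ⟶ E ⊗ c, ∀ m, b ⊵ₗ F.obj m ≫ (αₗ E c (F.obj m)).hom ≫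
      E ⊴ₗ μₗ F c m ≫ e (c ⊙ₗ m) = (αₗ c E (F.obj m)).hom ≫ c ⊴ₗ e m ≫ μₗ F' c m := by
    intro c
    refine rep_right huniv (ᘁc) c (c ⊗ E) _ fun m m' f => ?_
    have := hnat f
    simp only [tensor_actionHomRight, Category.assoc, Iso.inv_hom_id_assoc]
    rw [← actionHomRight_comp_assoc, this, actionHomRight_comp_assoc, μₗ_naturality_right]
  choose b hb using hb
  choose g hg using hg
  let β : ∀ c : C, E ⊗ c ≅ c ⊗ E := fun c =>
    { hom := b c
      inv := g c
      hom_inv_id := by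
        refine rep_right_ext huniv hnat (ᘁc) c _ _ _ fun m => ?_
        have h1 := hb c m
        rw [comp_actionHomLeft, Category.assoc, hg, reassoc_of% h1]
        simp
      inv_hom_id := by
        refine rep_left_ext huniv hnat c cᘁ _ _ _ fun m => ?_
        have h1 := hg c m
        rw [comp_actionHomLeft, Category.assoc, hb, reassoc_of% h1]
        simp }
  refine ⟨⟨β, fun c c' => ?_, fun {c c'} f => ?_⟩, fun c m => ?_⟩
  · refine rep_left_ext huniv hnat (c ⊗ c') (c ⊗ c')ᘁ _ _ _ fun m => ?_
    have hb' : ∀ (c : C) (m : M), E ⊴ₗ μₗ F c m ≫ e (c ⊙ₗ m) = (αₗ E c (F.obj m)).inv ≫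
        b c ⊵ₗ F.obj m ≫ (αₗ c E (F.obj m)).hom ≫ c ⊴ₗ e m ≫ μₗ F' c m := by
      intro c m
      have h1 := hb c m
      rw [reassoc_of% h1]; simp
    have hA : ∀ (x y z : C) (n : N), (α_ x y z).inv ⊵ₗ n ≫ (αₗ (x ⊗ y) z n).hom =
        (αₗ x (y ⊗ z) n).hom ≫ x ⊴ₗ (αₗ y z n).hom ≫ (αₗ x y (z ⊙ₗ n)).inv := by
      intro x y z n
      have h0 := associator_actionHom x y z n
      rw [← cancel_epi ((α_ x y z).hom ⊵ₗ n), reassoc_of% h0, ← comp_actionHomLeft_assoc]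
      simp
    have hA2 : ∀ (x y z : C) (n : N), (α_ x y z).hom ⊵ₗ n ≫ (αₗ x (y ⊗ z) n).hom =
        (αₗ (x ⊗ y) z n).hom ≫ (αₗ x y (z ⊙ₗ n)).hom ≫ x ⊴ₗ (αₗ y z n).inv := by
      intro x y z n
      rw [← cancel_mono (x ⊴ₗ (αₗ y z n).hom)]
      simp only [Category.assoc, associator_actionHom]
      rw [← actionHomRight_comp]; simp
    rw [← cancel_mono ((αₗ c c' _).hom ≫ c ⊴ₗ μₗ F' c' m ≫ μₗ F' c (c' ⊙ₗ m))]
    have hn := hnat (αₗ c c' m).hom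
    have h1 := hb (c ⊗ c') m
    have h2 := congrArg (fun t => c ⊴ₗ t) (hb' c' m)
    simp only [actionHomRight_comp] at h2
    have h3 : (αₗ E c (c' ⊙ₗ F.obj m)).inv ≫ b c ⊵ₗ (c' ⊙ₗ F.obj m) ≫
        (αₗ c E (c' ⊙ₗ F.obj m)).hom ≫ c ⊴ₗ E ⊴ₗ μₗ F c' m = E ⊴ₗ c ⊴ₗ μₗ F c' m ≫
        (αₗ E c (F.obj (c' ⊙ₗ m))).inv ≫ b c ⊵ₗ F.obj (c' ⊙ₗ m) ≫
          (αₗ c E (F.obj (c' ⊙ₗ m))).hom := by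
      have h4 := action_exchange (b c) (μₗ F c' m)
      simp only [tensor_actionHomRight, Category.assoc] at h4
      rw [← cancel_epi (αₗ E c (c' ⊙ₗ F.obj m)).hom, reassoc_of% h4]
      simp
    simp only [Category.assoc]
    rw [reassoc_of% h1, ← μₗ_associativity, LeftLinear.δₗ_comp_μₗ_assoc, ← hn,
      ← actionHomRight_comp_assoc, μₗ_associativity]
    simp only [β, comp_actionHomLeft, Category.assoc, whiskerLeft_actionHomLeft,
      whiskerRight_actionHomLeft, Iso.inv_hom_id_assoc, tensor_actionHomRight,
      actionHomRight_comp, hb', reassoc_of% hA, reassoc_of% hA2, μₗ_associativity]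
    rw [← reassoc_of% h2, reassoc_of% h3]
  · refine rep_left_ext huniv hnat c' c'ᘁ _ _ _ fun m => ?_
    have h1 := hnat (f ⊵ₗ m)
    simp only [β, comp_actionHomLeft, Category.assoc, hb, whiskerLeft_actionHomLeft,
      whiskerRight_actionHomLeft, Iso.inv_hom_id_assoc, action_exchange]
    have h2 := hb c m
    rw [← actionHomRight_comp_assoc, μₗ_naturality_left, actionHomRight_comp_assoc,
      reassoc_of% h1, δₗ_naturality_left, ← action_exchange, reassoc_of% h2]
  · have h1 := hb c m
    simp only [β]
    rw [reassoc_of% h1]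
    simp

theorem nonempty_internalNat [RigidCategory C] [HasInternalHoms C N] (hnat : IsNatFam E F F' e)
    (huniv : ∀ (c : C) (φ : ∀ m, c ⊙ₗ F.obj m ⟶ F'.obj m), IsNatFam c F F' φ →
      ∃! g : c ⟶ E, ∀ m, g ⊵ₗ F.obj m ≫ e m = φ m) : Nonempty (InternalNat C F F') := by
  obtain ⟨B, hB⟩ := halfBraiding_of_rep (C := C) (F := F) (F' := F') huniv hnat
  have he : (fun m => (iCurry (e m) : E ⟶ _) ⊵ₗ F.obj m ≫ iEv C (F.obj m) (F'.obj m)) = e :=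
    funext fun m => iCurry_ev (e m)
  refine ⟨⟨⟨E, B⟩, fun m => iCurry (e m), (isDinat_iff _).2 ?_, fun c φ hφ => ?_, ?_⟩⟩
  · rwa [he]
  · obtain ⟨g, hg, hu⟩ := huniv c _ ((isDinat_iff φ).1 hφ)
    refine ⟨g, fun m => iHom_ext ?_, fun g' hg' => hu g' fun m => ?_⟩
    · rw [comp_actionHomLeft, Category.assoc, iCurry_ev, hg]
    · rw [← hg', comp_actionHomLeft, Category.assoc, iCurry_ev]
  · have := hB
    rwa [← he] at this
end HalfBraiding

section HorizontalGeneral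
open scoped MonoidalLeftAction
open Functor Functor.LaxLeftLinear Functor.OplaxLeftLinear MonoidalLeftAction

variable {C : Type u} [Category.{v} C] [MonoidalCategory C]
variable {M : Type u₁} [Category.{v₁} M] [MonoidalLeftAction C M]
variable {N : Type u₂} [Category.{v₂} N] [MonoidalLeftAction C N]
variable {L : Type u₃} [Category.{v₃} L] [MonoidalLeftAction C L]

/-- The composite of module functors is a module functor. -/
instance compLeftLinear (F : M ⥤ N) (G : N ⥤ L) [F.LeftLinear C] [G.LeftLinear C] :
    (F ⋙ G).LeftLinear C where
  μₗ c m := μₗ G c (F.obj m) ≫ G.map (μₗ F c m)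
  δₗ c m := G.map (δₗ F c m) ≫ δₗ G c (F.obj m)
  μₗ_naturality_left f m := by
    simp only [Functor.comp_obj, Functor.comp_map, Category.assoc, ← G.map_comp]
    rw [μₗ_naturality_left_assoc, ← G.map_comp, μₗ_naturality_left]
  μₗ_naturality_right c m m' f := by
    simp only [Functor.comp_obj, Functor.comp_map, Category.assoc, ← G.map_comp]
    rw [μₗ_naturality_right_assoc, ← G.map_comp, μₗ_naturality_right]
  μₗ_associativity c c' m := by
    simp only [Functor.comp_obj, Functor.comp_map, Category.assoc, ← G.map_comp,
      μₗ_associativity, actionHomRight_comp]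
    rw [μₗ_naturality_right_assoc, G.map_comp, μₗ_associativity_assoc, ← G.map_comp]
  μₗ_unitality m := by
    simp only [Functor.comp_obj, Functor.comp_map, Category.assoc, ← G.map_comp]
    rw [← μₗ_unitality, ← μₗ_unitality]
  δₗ_naturality_left f m := by
    simp only [Functor.comp_obj, Functor.comp_map, Category.assoc]
    rw [← δₗ_naturality_left, ← G.map_comp_assoc, ← G.map_comp_assoc, δₗ_naturality_left]
  δₗ_naturality_right c m m' f := by
    simp only [Functor.comp_obj, Functor.comp_map, Category.assoc]
    rw [← δₗ_naturality_right, ← G.map_comp_assoc, ← G.map_comp_assoc, δₗ_naturality_right]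
  δₗ_associativity c c' m := by
    simp only [Functor.comp_obj, Functor.comp_map, Category.assoc, actionHomRight_comp]
    rw [← δₗ_naturality_right_assoc, δₗ_associativity]
    simp only [← G.map_comp_assoc, Category.assoc]
    rw [δₗ_associativity]
  δₗ_unitality_inv m := by
    simp only [Functor.comp_obj, Functor.comp_map]
    rw [← G.map_comp_assoc, ← δₗ_unitality_inv, ← δₗ_unitality_inv]
  μₗ_comp_δₗ c m := by
    change (μₗ G c (F.obj m) ≫ G.map (μₗ F c m)) ≫ G.map (δₗ F c m) ≫ δₗ G c (F.obj m) = _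
    rw [Category.assoc, ← G.map_comp_assoc]
    simp
  δₗ_comp_μₗ c m := by
    change (G.map (δₗ F c m) ≫ δₗ G c (F.obj m)) ≫ μₗ G c (F.obj m) ≫ G.map (μₗ F c m) = _
    rw [Category.assoc, LeftLinear.δₗ_comp_μₗ_assoc, ← G.map_comp]
    simp

theorem IsNatFam.map {c : C} {F F' : M ⥤ N} {φ : ∀ m, c ⊙ₗ F.obj m ⟶ F'.obj m}
    (h : IsNatFam c F F' φ) (G : N ⥤ L) [G.LeftLinear C] :
    IsNatFam c (F ⋙ G) (F' ⋙ G) (fun m => μₗ G c (F.obj m) ≫ G.map (φ m)) := by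
  intro m m' f
  simp only [Functor.comp_map, Category.assoc, ← G.map_comp]
  rw [μₗ_naturality_right_assoc, ← G.map_comp, h f]

theorem IsModFam.map {Z : Center C} {F F' : M ⥤ N} [F.LeftLinear C] [F'.LeftLinear C]
    {φ : ∀ m, Z.1 ⊙ₗ F.obj m ⟶ F'.obj m}
    (h : IsModFam Z F F' φ) (G : N ⥤ L) [G.LeftLinear C] :
    IsModFam Z (F ⋙ G) (F' ⋙ G) (fun m => μₗ G Z.1 (F.obj m) ≫ G.map (φ m)) := by
  intro c m
  change Z.1 ⊴ₗ (μₗ G c (F.obj m) ≫ G.map (μₗ F c m)) ≫ _ =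
    (αₗ Z.1 c (G.obj (F.obj m))).inv ≫ (Z.2.β c).hom ⊵ₗ G.obj (F.obj m) ≫
      (αₗ c Z.1 (G.obj (F.obj m))).hom ≫ _ ≫ (μₗ G c (F'.obj m) ≫ G.map (μₗ F' c m))
  have h1 := congrArg G.map (h c m)
  simp only [G.map_comp] at h1
  simp only [actionHomRight_comp, Category.assoc, Functor.comp_obj]
  rw [μₗ_naturality_right_assoc, h1, μₗ_associativity_inv_assoc, ← μₗ_naturality_left_assoc,
    μₗ_associativity_assoc, μₗ_naturality_right_assoc]

theorem IsNatFam.pre {c : C} {G G' : N ⥤ L} {φ : ∀ m, c ⊙ₗ G.obj m ⟶ G'.obj m}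
    (h : IsNatFam c G G' φ) (K : M ⥤ N) :
    IsNatFam c (K ⋙ G) (K ⋙ G') (fun m => φ (K.obj m)) :=
  fun _ _ f => h (K.map f)

theorem IsModFam.pre {Z : Center C} {G G' : N ⥤ L} [G.LeftLinear C] [G'.LeftLinear C]
    {φ : ∀ m, Z.1 ⊙ₗ G.obj m ⟶ G'.obj m} (hn : IsNatFam Z.1 G G' φ)
    (h : IsModFam Z G G' φ) (K : M ⥤ N) [K.LeftLinear C] :
    IsModFam Z (K ⋙ G) (K ⋙ G') (fun m => φ (K.obj m)) := by
  intro c m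
  change Z.1 ⊴ₗ (μₗ G c (K.obj m) ≫ G.map (μₗ K c m)) ≫ φ (K.obj (c ⊙ₗ m)) =
    (αₗ Z.1 c (G.obj (K.obj m))).inv ≫ (Z.2.β c).hom ⊵ₗ G.obj (K.obj m) ≫
      (αₗ c Z.1 (G.obj (K.obj m))).hom ≫ _ ≫ (μₗ G' c (K.obj m) ≫ G'.map (μₗ K c m))
  have h1 := h c (K.obj m)
  simp only [actionHomRight_comp, Category.assoc, hn (μₗ K c m), reassoc_of% h1]

theorem IsNatFam.comp {c d : C} {F F' F'' : M ⥤ N} {φ : ∀ m, c ⊙ₗ F'.obj m ⟶ F''.obj m}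
    {ψ : ∀ m, d ⊙ₗ F.obj m ⟶ F'.obj m}
    (hφ : IsNatFam c F' F'' φ) (hψ : IsNatFam d F F' ψ) :
    IsNatFam (c ⊗ d) F F'' (fun m => (αₗ c d (F.obj m)).hom ≫ c ⊴ₗ ψ m ≫ φ m) := by
  intro m m' f
  simp only [tensor_actionHomRight, Category.assoc, Iso.inv_hom_id_assoc]
  rw [← actionHomRight_comp_assoc, hψ f, actionHomRight_comp_assoc, hφ f]

theorem IsModFam.comp {W Z : Center C} {F F' F'' : M ⥤ N} [F.LeftLinear C] [F'.LeftLinear C]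
    [F''.LeftLinear C] {φ : ∀ m, W.1 ⊙ₗ F'.obj m ⟶ F''.obj m}
    {ψ : ∀ m, Z.1 ⊙ₗ F.obj m ⟶ F'.obj m}
    (hφ : IsModFam W F' F'' φ) (hψ : IsModFam Z F F' ψ) :
    IsModFam (W ⊗ Z) F F'' (fun m => (αₗ W.1 Z.1 (F.obj m)).hom ≫ W.1 ⊴ₗ ψ m ≫ φ m) := by
  intro c m
  change (W.1 ⊗ Z.1) ⊴ₗ μₗ F c m ≫ (αₗ W.1 Z.1 (F.obj (c ⊙ₗ m))).hom ≫ _ =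
    (αₗ (W.1 ⊗ Z.1) c (F.obj m)).inv ≫
    ((α_ W.1 Z.1 c).hom ≫ W.1 ◁ (Z.2.β c).hom ≫ (α_ W.1 c Z.1).inv ≫ (W.2.β c).hom ▷ Z.1 ≫
      (α_ c W.1 Z.1).hom) ⊵ₗ F.obj m ≫ (αₗ c (W.1 ⊗ Z.1) (F.obj m)).hom ≫ _
  have h1 := hφ c m
  have h2 := congrArg (fun t => W.1 ⊴ₗ t) (hψ c m)
  simp only [actionHomRight_comp] at h2
  have hA : ∀ (x y z : C) (n : N), (α_ x y z).inv ⊵ₗ n ≫ (αₗ (x ⊗ y) z n).hom =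
      (αₗ x (y ⊗ z) n).hom ≫ x ⊴ₗ (αₗ y z n).hom ≫ (αₗ x y (z ⊙ₗ n)).inv := by
    intro x y z n
    have h0 := associator_actionHom x y z n
    rw [← cancel_epi ((α_ x y z).hom ⊵ₗ n), reassoc_of% h0, ← comp_actionHomLeft_assoc]
    simp
  have hA2 : ∀ (x y z : C) (n : N), (α_ x y z).hom ⊵ₗ n ≫ (αₗ x (y ⊗ z) n).hom =
      (αₗ (x ⊗ y) z n).hom ≫ (αₗ x y (z ⊙ₗ n)).hom ≫ x ⊴ₗ (αₗ y z n).inv := by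
    intro x y z n
    rw [← cancel_mono (x ⊴ₗ (αₗ y z n).hom)]
    simp only [Category.assoc, associator_actionHom]
    rw [← actionHomRight_comp]; simp
  have h3 : (αₗ W.1 c (Z.1 ⊙ₗ F.obj m)).inv ≫ (W.2.β c).hom ⊵ₗ (Z.1 ⊙ₗ F.obj m) ≫
      (αₗ c W.1 (Z.1 ⊙ₗ F.obj m)).hom ≫ c ⊴ₗ W.1 ⊴ₗ ψ m = W.1 ⊴ₗ c ⊴ₗ ψ m ≫
      (αₗ W.1 c (F'.obj m)).inv ≫ (W.2.β c).hom ⊵ₗ F'.obj m ≫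
        (αₗ c W.1 (F'.obj m)).hom := by
    have h4 := action_exchange (W.2.β c).hom (ψ m)
    simp only [tensor_actionHomRight, Category.assoc] at h4
    rw [← cancel_epi (αₗ W.1 c (Z.1 ⊙ₗ F.obj m)).hom, reassoc_of% h4]
    simp
  simp only [comp_actionHomLeft, Category.assoc, whiskerLeft_actionHomLeft,
    whiskerRight_actionHomLeft, Iso.inv_hom_id_assoc, tensor_actionHomRight,
    actionHomRight_comp, h1, reassoc_of% h2, reassoc_of% hA, reassoc_of% hA2]
  rw [← reassoc_of% h3]
  simp [reassoc_of% hA2]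

end HorizontalGeneral

section HorizontalProducts
open scoped MonoidalLeftAction
open Functor Functor.LaxLeftLinear Functor.OplaxLeftLinear MonoidalLeftAction

variable {C : Type u} [Category.{v} C] [MonoidalCategory C]
variable {M : Type u₁} [Category.{v₁} M] [MonoidalLeftAction C M]
variable {N : Type u₂} [Category.{v₂} N] [MonoidalLeftAction C N]
variable {L : Type u₃} [Category.{v₃} L] [MonoidalLeftAction C L]

section Lift

variable [HasInternalHoms C N] {F F' : M ⥤ N} [F.LeftLinear C] [F'.LeftLinear C]

theorem InternalNat.ev_universal (I : InternalNat C F F') (c : C)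
    (φ : ∀ m, c ⊙ₗ F.obj m ⟶ F'.obj m) (hφ : IsNatFam c F F' φ) :
    ∃! g : c ⟶ I.obj.1, ∀ m, g ⊵ₗ F.obj m ≫ I.j m ⊵ₗ F.obj m ≫ iEv C _ _ = φ m := by
  have he : (fun m => (iCurry (φ m) : c ⟶ _) ⊵ₗ F.obj m ≫ iEv C (F.obj m) (F'.obj m)) = φ :=
    funext fun m => iCurry_ev (φ m)
  obtain ⟨g, hg, hu⟩ := I.exists_unique c (fun m => iCurry (φ m))
    ((isDinat_iff _).2 (by rwa [he]))
  refine ⟨g, fun m => ?_, fun g' hg' => hu g' fun m => iHom_ext ?_⟩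
  · rw [← comp_actionHomLeft_assoc, hg, iCurry_ev]
  · rw [comp_actionHomLeft, Category.assoc, hg', iCurry_ev]

/-- The morphism into an object of internal natural transformations that is induced by a dinatural
family whose evaluations form a module natural transformation; it is a morphism in the center. -/
noncomputable def InternalNat.lift [RigidCategory C] (I : InternalNat C F F') (Z : Center C)
    (φ : ∀ m, Z.1 ⟶ iHom C (F.obj m) (F'.obj m)) (hd : IsDinat Z.1 F F' φ)
    (hm : IsModFam Z F F' (fun m => φ m ⊵ₗ F.obj m ≫ iEv C _ _)) : Z ⟶ I.obj where
  f := (I.exists_unique Z.1 φ hd).choose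
  comm c := by
    have hf := (I.exists_unique Z.1 φ hd).choose_spec.1
    have hf' : ∀ m, (I.exists_unique Z.1 φ hd).choose ⊵ₗ F.obj m ≫
        I.j m ⊵ₗ F.obj m ≫ iEv C _ _ = φ m ⊵ₗ F.obj m ≫ iEv C _ _ := fun m => by
      rw [← comp_actionHomLeft_assoc, hf]
    refine rep_left_ext I.ev_universal ((isDinat_iff _).1 I.dinat) c cᘁ _ _ _ fun m => ?_
    have h1 := I.isMod c m
    have h2 := hm c m
    rw [← cancel_mono (μₗ F' c m), ← cancel_epi (αₗ Z.1 c (F.obj m)).inv]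
    have h3 : ∀ t : Z.1 ⟶ I.obj.1, (αₗ Z.1 c (F.obj m)).inv ≫ (t ▷ c) ⊵ₗ F.obj m =
        t ⊵ₗ (c ⊙ₗ F.obj m) ≫ (αₗ I.obj.1 c (F.obj m)).inv := by
      intro t; simp
    simp only [comp_actionHomLeft, Category.assoc, whiskerLeft_actionHomLeft,
      Iso.inv_hom_id_assoc] at h1 h2 ⊢
    rw [reassoc_of% h3, ← h1, ← action_exchange_assoc, hf', h2, ← actionHomRight_comp_assoc, hf']

end Lift

section Products

variable [HasInternalHoms C N] [HasInternalHoms C L]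
variable {G₁ G₃ : M ⥤ N} {G₂ G₄ : N ⥤ L} [G₁.LeftLinear C] [G₂.LeftLinear C]
  [G₃.LeftLinear C] [G₄.LeftLinear C]

/-- The family `(j ⊗ j) ; (id ⊗ iG₂) ; imu` that defines the left horizontal product. -/
noncomputable def horLeftFam (I₂₄ : InternalNat C G₂ G₄) (I₁₃ : InternalNat C G₁ G₃) (m : M) :
    I₂₄.obj.1 ⊗ I₁₃.obj.1 ⟶ iHom C ((G₁ ⋙ G₂).obj m) ((G₃ ⋙ G₄).obj m) :=
  (I₂₄.j (G₃.obj m) ⊗ₘ I₁₃.j m) ≫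
    iHom C (G₂.obj (G₃.obj m)) (G₄.obj (G₃.obj m)) ◁ iFun C G₂ (G₁.obj m) (G₃.obj m) ≫
    iMul C (G₂.obj (G₁.obj m)) (G₂.obj (G₃.obj m)) (G₄.obj (G₃.obj m))

/-- The family `(j ⊗ j) ; (iG₄ ⊗ id) ; imu` that defines the right horizontal product. -/
noncomputable def horRightFam (I₂₄ : InternalNat C G₂ G₄) (I₁₃ : InternalNat C G₁ G₃) (m : M) :
    I₁₃.obj.1 ⊗ I₂₄.obj.1 ⟶ iHom C ((G₁ ⋙ G₂).obj m) ((G₃ ⋙ G₄).obj m) :=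
  (I₁₃.j m ⊗ₘ I₂₄.j (G₁.obj m)) ≫
    iFun C G₄ (G₁.obj m) (G₃.obj m) ▷ iHom C (G₂.obj (G₁.obj m)) (G₄.obj (G₁.obj m)) ≫
    iMul C (G₂.obj (G₁.obj m)) (G₄.obj (G₁.obj m)) (G₄.obj (G₃.obj m))

variable (I₂₄ : InternalNat C G₂ G₄) (I₁₃ : InternalNat C G₁ G₃)

theorem horLeftFam_ev (m : M) :
    horLeftFam I₂₄ I₁₃ m ⊵ₗ G₂.obj (G₁.obj m) ≫ iEv C _ _ =
      (αₗ I₂₄.obj.1 I₁₃.obj.1 _).hom ≫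
        I₂₄.obj.1 ⊴ₗ (μₗ G₂ I₁₃.obj.1 (G₁.obj m) ≫
          G₂.map (I₁₃.j m ⊵ₗ G₁.obj m ≫ iEv C _ _)) ≫
        I₂₄.j (G₃.obj m) ⊵ₗ G₂.obj (G₃.obj m) ≫ iEv C _ _ := by
  simp only [horLeftFam, tensorHom_def', comp_actionHomLeft, Category.assoc,
    whiskerLeft_actionHomLeft, whiskerRight_actionHomLeft, Functor.comp_obj,
    Functor.map_comp, actionHomRight_comp]
  have h1 := congrArg (fun t => iHom C (G₂.obj (G₃.obj m)) (G₄.obj (G₃.obj m)) ⊴ₗ t)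
    (iFun_ev (C := C) G₂ (G₁.obj m) (G₃.obj m))
  simp only [actionHomRight_comp] at h1
  rw [iMul_ev]
  simp only [Iso.inv_hom_id_assoc, reassoc_of% h1]
  rw [← action_exchange_assoc, ← action_exchange_assoc, ← actionHomRight_comp_assoc,
    μₗ_naturality_left]
  simp

theorem horRightFam_ev (m : M) :
    horRightFam I₂₄ I₁₃ m ⊵ₗ G₂.obj (G₁.obj m) ≫ iEv C _ _ =
      (αₗ I₁₃.obj.1 I₂₄.obj.1 _).hom ≫
        I₁₃.obj.1 ⊴ₗ (I₂₄.j (G₁.obj m) ⊵ₗ G₂.obj (G₁.obj m) ≫ iEv C _ _) ≫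
        μₗ G₄ I₁₃.obj.1 (G₁.obj m) ≫
          G₄.map (I₁₃.j m ⊵ₗ G₁.obj m ≫ iEv C _ _) := by
  simp only [horRightFam, tensorHom_def', comp_actionHomLeft, Category.assoc,
    whiskerLeft_actionHomLeft, whiskerRight_actionHomLeft, Functor.comp_obj,
    Functor.map_comp, actionHomRight_comp]
  rw [iMul_ev]
  simp only [Iso.inv_hom_id_assoc]
  rw [← action_exchange_assoc, iFun_ev, ← action_exchange_assoc, μₗ_naturality_left_assoc]

theorem horLeftFam_dinat : IsDinat (I₂₄.obj ⊗ I₁₃.obj).1 (G₁ ⋙ G₂) (G₃ ⋙ G₄)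
    (horLeftFam I₂₄ I₁₃) := by
  refine (isDinat_iff _).2 ?_
  exact Eq.mpr (congrArg (IsNatFam (I₂₄.obj.1 ⊗ I₁₃.obj.1) (G₁ ⋙ G₂) (G₃ ⋙ G₄))
    (funext (horLeftFam_ev I₂₄ I₁₃))) (IsNatFam.comp (((isDinat_iff _).1 I₂₄.dinat).pre G₃)
    (((isDinat_iff _).1 I₁₃.dinat).map G₂))

theorem horLeftFam_isMod : IsModFam (I₂₄.obj ⊗ I₁₃.obj) (G₁ ⋙ G₂) (G₃ ⋙ G₄)
    (fun m => horLeftFam I₂₄ I₁₃ m ⊵ₗ (G₁ ⋙ G₂).obj m ≫ iEv C _ _) := by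
  exact Eq.mpr (congrArg (IsModFam (I₂₄.obj ⊗ I₁₃.obj) (G₁ ⋙ G₂) (G₃ ⋙ G₄))
    (funext (horLeftFam_ev I₂₄ I₁₃))) (IsModFam.comp (I₂₄.isMod.pre ((isDinat_iff _).1 I₂₄.dinat) G₃)
    (I₁₃.isMod.map G₂))

theorem horRightFam_dinat : IsDinat (I₁₃.obj ⊗ I₂₄.obj).1 (G₁ ⋙ G₂) (G₃ ⋙ G₄)
    (horRightFam I₂₄ I₁₃) := by
  refine (isDinat_iff _).2 ?_
  exact Eq.mpr (congrArg (IsNatFam (I₁₃.obj.1 ⊗ I₂₄.obj.1) (G₁ ⋙ G₂) (G₃ ⋙ G₄))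
    (funext (horRightFam_ev I₂₄ I₁₃))) (IsNatFam.comp (((isDinat_iff _).1 I₁₃.dinat).map G₄)
    (((isDinat_iff _).1 I₂₄.dinat).pre G₁))

theorem horRightFam_isMod : IsModFam (I₁₃.obj ⊗ I₂₄.obj) (G₁ ⋙ G₂) (G₃ ⋙ G₄)
    (fun m => horRightFam I₂₄ I₁₃ m ⊵ₗ (G₁ ⋙ G₂).obj m ≫ iEv C _ _) := by
  exact Eq.mpr (congrArg (IsModFam (I₁₃.obj ⊗ I₂₄.obj) (G₁ ⋙ G₂) (G₃ ⋙ G₄))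
    (funext (horRightFam_ev I₂₄ I₁₃))) (IsModFam.comp (I₁₃.isMod.map G₄)
    (I₂₄.isMod.pre ((isDinat_iff _).1 I₂₄.dinat) G₁))

variable [RigidCategory C] (I : InternalNat C (G₁ ⋙ G₂) (G₃ ⋙ G₄))

/-- The left horizontal product of internal natural transformations. -/
noncomputable def horLeft : I₂₄.obj ⊗ I₁₃.obj ⟶ I.obj :=
  I.lift _ (horLeftFam I₂₄ I₁₃) (horLeftFam_dinat I₂₄ I₁₃) (horLeftFam_isMod I₂₄ I₁₃)

/-- The right horizontal product of internal natural transformations. -/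
noncomputable def horRight : I₁₃.obj ⊗ I₂₄.obj ⟶ I.obj :=
  I.lift _ (horRightFam I₂₄ I₁₃) (horRightFam_dinat I₂₄ I₁₃) (horRightFam_isMod I₂₄ I₁₃)

end Products

section Transport

variable [HasInternalHoms C N] {F F' H H' : M ⥤ N} [F.LeftLinear C] [F'.LeftLinear C]
  [H.LeftLinear C] [H'.LeftLinear C]

variable (C) in
/-- A natural transformation of module functors that respects the module structures. -/
def IsModNat (a : F ⟶ H) : Prop :=
  ∀ (c : C) (m : M), μₗ F c m ≫ a.app (c ⊙ₗ m) = c ⊴ₗ a.app m ≫ μₗ H c m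

theorem IsModNat.inv {a : F ≅ H} (ha : IsModNat C a.hom) : IsModNat C a.inv := by
  intro c m
  rw [← cancel_mono (a.hom.app (c ⊙ₗ m)), Category.assoc, Category.assoc, ha c m,
    ← actionHomRight_comp_assoc]
  simp

theorem InternalNat.ofIso_ev (I : InternalNat C F F') (a : F ≅ H) (b : F' ≅ H') (m : M) :
    (I.j m ≫ iHomPre C (a.inv.app m) (F'.obj m) ≫ iHomPost C (H.obj m) (b.hom.app m)) ⊵ₗ
      H.obj m ≫ iEv C (H.obj m) (H'.obj m) =
    I.obj.1 ⊴ₗ a.inv.app m ≫ I.j m ⊵ₗ F.obj m ≫ iEv C _ _ ≫ b.hom.app m := by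
  simp only [comp_actionHomLeft, Category.assoc]
  have h1 := iHomPre_ev (C := C) (a.inv.app m) (F'.obj m)
  rw [iHomPost_ev, reassoc_of% h1, ← action_exchange_assoc]

/-- Internal natural transformations only depend on the module functors up to module natural
isomorphism. -/
noncomputable def InternalNat.ofIso (I : InternalNat C F F') (a : F ≅ H) (b : F' ≅ H')
    (ha : IsModNat C a.hom) (hb : IsModNat C b.hom) : InternalNat C H H' where
  obj := I.obj
  j m := I.j m ≫ iHomPre C (a.inv.app m) (F'.obj m) ≫ iHomPost C (H.obj m) (b.hom.app m)
  dinat := by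
    refine (isDinat_iff _).2 ?_
    rw [funext (I.ofIso_ev a b)]
    intro m m' f
    have h1 := (isDinat_iff _).1 I.dinat f
    simp only [Category.assoc] at h1 ⊢
    rw [← actionHomRight_comp_assoc, a.inv.naturality, actionHomRight_comp_assoc,
      reassoc_of% h1, b.hom.naturality]
  exists_unique c φ hφ := by
    have hφ' := (isDinat_iff _).1 hφ
    obtain ⟨g, hg, hu⟩ := I.ev_universal c
      (fun m => c ⊴ₗ a.hom.app m ≫ φ m ⊵ₗ H.obj m ≫ iEv C _ _ ≫ b.inv.app m) (by
        intro m m' f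
        have h1 := hφ' f
        simp only [Category.assoc] at h1 ⊢
        rw [← actionHomRight_comp_assoc, a.hom.naturality, actionHomRight_comp_assoc,
          reassoc_of% h1, b.inv.naturality])
    refine ⟨g, fun m => iHom_ext ?_, fun g' hg' => hu g' fun m => ?_⟩
    · have h1 := hg m
      rw [comp_actionHomLeft, Category.assoc, I.ofIso_ev, ← action_exchange_assoc,
        reassoc_of% h1, ← actionHomRight_comp_assoc]
      simp
    · rw [← hg' m, comp_actionHomLeft, Category.assoc]
      have h1 := I.ofIso_ev a b m
      rw [reassoc_of% h1, ← action_exchange_assoc, ← actionHomRight_comp_assoc]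
      simp
  isMod := by
    rw [funext (I.ofIso_ev a b)]
    intro c m
    have h1 := I.isMod c m
    have hb1 := hb c m
    have ha1 : μₗ H c m ≫ a.inv.app (c ⊙ₗ m) = c ⊴ₗ a.inv.app m ≫ μₗ F c m := ha.inv c m
    have h2 := action_exchange (I.obj.2.β c).hom (a.inv.app m)
    simp only [tensor_actionHomRight, Category.assoc] at h1 h2 ⊢
    have h3 := congrArg (fun t => (αₗ I.obj.1 c (H.obj m)).inv ≫ t ≫ (αₗ c I.obj.1 _).hom) h2
    simp only [Category.assoc, Iso.inv_hom_id, Iso.inv_hom_id_assoc, Category.comp_id] at h3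
    rw [← actionHomRight_comp_assoc, ha1, actionHomRight_comp_assoc, reassoc_of% h1, hb1]
    simp only [actionHomRight_comp, Category.assoc]
    rw [reassoc_of% h3]

end Transport

end HorizontalProducts

section RightModules

open scoped MonoidalLeftAction MonObj

variable {C : Type u} [Category.{v} C] [MonoidalCategory C]

/-- Right modules over an algebra `A`, as bimodules over the tensor unit and `A`. -/
abbrev RMod (A : Mon C) := Bimod (Mon.trivial C) A

namespace RMod

variable {A : Mon C}

/-- The left action of the tensor unit on a right module is the left unitor. -/
theorem actLeft_eq (M : RMod A) : M.actLeft = (λ_ M.X).hom := by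
  have h := M.one_actLeft
  have h2 : (MonObj.one : 𝟙_ C ⟶ (Mon.trivial C).X) ▷ M.X = 𝟙 (𝟙_ C ⊗ M.X) :=
    id_whiskerRight _ _
  refine Eq.trans ?_ h
  refine Eq.trans ?_ (congrArg (fun t => t ≫ M.actLeft) h2).symm
  exact (Category.id_comp (show 𝟙_ C ⊗ M.X ⟶ M.X from M.actLeft)).symm

/-- A right module from its underlying object and its right action. -/
def mk (X : C) (act : X ⊗ A.X ⟶ X) (one : X ◁ η[A.X] ≫ act = (ρ_ X).hom)
    (assoc : X ◁ μ[A.X] ≫ act = (α_ X A.X A.X).inv ≫ act ▷ A.X ≫ act) : RMod A where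
  X := X
  actLeft := (λ_ X).hom
  one_actLeft := by
    have h2 : (MonObj.one : 𝟙_ C ⟶ (Mon.trivial C).X) ▷ X = 𝟙 (𝟙_ C ⊗ X) := id_whiskerRight _ _
    exact (congrArg (fun t => t ≫ (λ_ X).hom) h2).trans (Category.id_comp _)
  left_assoc := by
    change (λ_ (𝟙_ C)).hom ▷ X ≫ (λ_ X).hom = (α_ (𝟙_ C) (𝟙_ C) X).hom ≫
      𝟙_ C ◁ (λ_ X).hom ≫ (λ_ X).hom
    monoidal
  actRight := act
  actRight_one := one
  right_assoc := assoc
  middle_assoc := by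
    change (λ_ X).hom ▷ A.X ≫ act = (α_ (𝟙_ C) X A.X).hom ≫ 𝟙_ C ◁ act ≫ (λ_ X).hom
    simp

/-- A morphism of right modules from a morphism that respects the right actions. -/
def homMk {M N : RMod A} (f : M.X ⟶ N.X) (hf : M.actRight ≫ f = f ▷ A.X ≫ N.actRight) :
    M ⟶ N where
  hom := f
  left_act_hom := by
    rw [actLeft_eq, actLeft_eq]
    exact (leftUnitor_naturality f).symm
  right_act_hom := hf

theorem homMk_hom {M N : RMod A} (f : M.X ⟶ N.X)
    (hf : M.actRight ≫ f = f ▷ A.X ≫ N.actRight) : (homMk f hf).hom = f := rfl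

/-- An isomorphism of right modules from an isomorphism that respects the right actions. -/
def isoMk {M N : RMod A} (f : M.X ≅ N.X) (hf : M.actRight ≫ f.hom = f.hom ▷ A.X ≫ N.actRight) :
    M ≅ N where
  hom := homMk f.hom hf
  inv := homMk f.inv (by
    rw [← cancel_mono f.hom, Category.assoc, Category.assoc, Iso.inv_hom_id, hf,
      ← comp_whiskerRight_assoc]
    simp)
  hom_inv_id := Bimod.hom_ext _ _ f.hom_inv_id
  inv_hom_id := Bimod.hom_ext _ _ f.inv_hom_id

/-- The right module `c ⊗ M`, with action `id ⊗ ρ`. -/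
def act (c : C) (M : RMod A) : RMod A :=
  mk (c ⊗ M.X) ((α_ c M.X A.X).hom ≫ c ◁ M.actRight)
    (by
      rw [associator_naturality_right_assoc, ← MonoidalCategory.whiskerLeft_comp, M.actRight_one]
      simp)
    (by
      rw [associator_naturality_right_assoc, ← MonoidalCategory.whiskerLeft_comp, M.right_assoc]
      simp)

/-- The category of right modules is a left module category over `C`. -/
instance : MonoidalLeftAction C (RMod A) where
  actionObj := act
  actionHomLeft {c c'} f M := homMk (M := act c M) (N := act c' M) (f ▷ M.X) (by
    change ((α_ c M.X A.X).hom ≫ c ◁ M.actRight) ≫ f ▷ M.X = f ▷ M.X ▷ A.X ≫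
      (α_ c' M.X A.X).hom ≫ c' ◁ M.actRight
    rw [Category.assoc, whisker_exchange]
    simp)
  actionHomRight c {M N} f := homMk (M := act c M) (N := act c N) (c ◁ f.hom) (by
    change ((α_ c M.X A.X).hom ≫ c ◁ M.actRight) ≫ c ◁ f.hom = (c ◁ f.hom) ▷ A.X ≫
      (α_ c N.X A.X).hom ≫ c ◁ N.actRight
    rw [Category.assoc, ← MonoidalCategory.whiskerLeft_comp, Bimod.Hom.right_act_hom]
    simp)
  actionAssocIso c d M := isoMk (M := act (c ⊗ d) M) (N := act c (act d M)) (α_ c d M.X) (by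
    change ((α_ (c ⊗ d) M.X A.X).hom ≫ (c ⊗ d) ◁ M.actRight) ≫ (α_ c d M.X).hom =
      (α_ c d M.X).hom ▷ A.X ≫ (α_ c (d ⊗ M.X) A.X).hom ≫
        c ◁ ((α_ d M.X A.X).hom ≫ d ◁ M.actRight)
    simp)
  actionUnitIso M := isoMk (M := act (𝟙_ C) M) (N := M) (λ_ M.X) (by
    change ((α_ (𝟙_ C) M.X A.X).hom ≫ 𝟙_ C ◁ M.actRight) ≫ (λ_ M.X).hom =
      (λ_ M.X).hom ▷ A.X ≫ M.actRight
    simp)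
  actionHomRight_id c M := Bimod.hom_ext _ _ (whiskerLeft_id c M.X)
  id_actionHomLeft c M := Bimod.hom_ext _ _ (id_whiskerRight c M.X)
  actionHom_comp {c c' c'' M M' M''} f₁ f₂ g₁ g₂ := Bimod.hom_ext _ _ (by
    change (f₁ ≫ f₂) ▷ M.X ≫ c'' ◁ (g₁.hom ≫ g₂.hom) =
      (f₁ ▷ M.X ≫ c' ◁ g₁.hom) ≫ f₂ ▷ M'.X ≫ c'' ◁ g₂.hom
    simp only [comp_whiskerRight, MonoidalCategory.whiskerLeft_comp, Category.assoc]
    rw [whisker_exchange_assoc])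
  actionAssocIso_hom_naturality {c₁ c₂ c₃ c₄ M N} f g h := Bimod.hom_ext _ _ (by
    change ((f ⊗ₘ g) ▷ M.X ≫ (c₂ ⊗ c₄) ◁ h.hom) ≫ (α_ c₂ c₄ N.X).hom =
      (α_ c₁ c₃ M.X).hom ≫ f ▷ (c₃ ⊗ M.X) ≫ c₂ ◁ (g ▷ M.X ≫ c₄ ◁ h.hom)
    simp [MonoidalCategory.tensorHom_def])
  actionUnitIso_hom_naturality {M N} f := Bimod.hom_ext _ _ (leftUnitor_naturality f.hom).symm
  whiskerLeft_actionHomLeft c {c' c''} f M := Bimod.hom_ext _ _ (by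
    change (c ◁ f) ▷ M.X = (α_ c c' M.X).hom ≫ c ◁ f ▷ M.X ≫ (α_ c c'' M.X).inv
    simp)
  whiskerRight_actionHomLeft {c c'} c'' f M := Bimod.hom_ext _ _ (by
    change (f ▷ c'') ▷ M.X = (α_ c c'' M.X).hom ≫ f ▷ (c'' ⊗ M.X) ≫ (α_ c' c'' M.X).inv
    simp)
  associator_actionHom c₁ c₂ c₃ M := Bimod.hom_ext _ _ (pentagon c₁ c₂ c₃ M.X)
  leftUnitor_actionHom c M := Bimod.hom_ext _ _ (leftUnitor_whiskerRight c M.X)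
  rightUnitor_actionHom c M := Bimod.hom_ext _ _ (triangle c M.X).symm

variable (c d : C) (M N : RMod A)

theorem act_X : (c ⊙ₗ M : RMod A).X = (c ⊗ M.X) := rfl
theorem act_actRight : (c ⊙ₗ M : RMod A).actRight = (α_ c M.X A.X).hom ≫ c ◁ M.actRight := rfl
theorem actionHomLeft_hom {c d : C} (f : c ⟶ d) : (f ⊵ₗ M).hom = f ▷ M.X := rfl
theorem actionHomRight_hom {M N : RMod A} (f : M ⟶ N) : (c ⊴ₗ f).hom = c ◁ f.hom := rfl

end RMod

end RightModules

section ModuleHoms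

open scoped MonoidalLeftAction MonObj

variable {C : Type u} [Category.{v} C] [MonoidalCategory C]

theorem exists_hom_obj [RigidCategory C] (X Y : C) : ∃ (H : C) (ε : H ⊗ X ⟶ Y),
    ∀ (c : C) (f : c ⊗ X ⟶ Y), ∃! g : c ⟶ H, g ▷ X ≫ ε = f := by
  refine ⟨Y ⊗ Xᘁ, (tensorRightHomEquiv _ X Xᘁ Y).symm (𝟙 _), fun c f => ?_⟩
  have h : ∀ g : c ⟶ Y ⊗ Xᘁ, g ▷ X ≫ (tensorRightHomEquiv _ X Xᘁ Y).symm (𝟙 _) =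
      (tensorRightHomEquiv _ X Xᘁ Y).symm g := by
    intro g
    rw [← tensorRightHomEquiv_symm_naturality, Category.comp_id]
  refine ⟨tensorRightHomEquiv _ X Xᘁ Y f, ?_, fun g hg => ?_⟩
  · exact (h _).trans (Equiv.symm_apply_apply _ _)
  · rw [← hg, h, Equiv.apply_symm_apply]

namespace RMod

theorem nonempty_internalHom [RigidCategory C] [HasEqualizers C] {A : Mon C} (M N : RMod A) :
    Nonempty (InternalHom C M N) := by
  obtain ⟨H, ε, hH⟩ := exists_hom_obj M.X N.X
  obtain ⟨K, κ, hK⟩ := exists_hom_obj ((M.X ⊗ A.X : C)) N.X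
  obtain ⟨t₁, h₁, -⟩ := hK H (H ◁ M.actRight ≫ ε)
  obtain ⟨t₂, h₂, -⟩ := hK H ((α_ H M.X A.X).inv ≫ ε ▷ A.X ≫ N.actRight)
  have key : ∀ (c : C) (g : c ⟶ H), g ≫ t₁ = g ≫ t₂ ↔
      (α_ c M.X A.X).hom ≫ c ◁ M.actRight ≫ g ▷ M.X ≫ ε =
        (g ▷ M.X ≫ ε) ▷ A.X ≫ N.actRight := by
    intro c g
    have e₁ : (g ≫ t₁) ▷ (M.X ⊗ A.X) ≫ κ = c ◁ M.actRight ≫ g ▷ M.X ≫ ε := by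
      rw [comp_whiskerRight, Category.assoc, h₁, whisker_exchange_assoc]
    have e₂ : (g ≫ t₂) ▷ (M.X ⊗ A.X) ≫ κ = (α_ c M.X A.X).inv ≫ (g ▷ M.X ≫ ε) ▷ A.X ≫
        N.actRight := by
      rw [comp_whiskerRight, Category.assoc, h₂]; simp
    rw [← Iso.eq_inv_comp, ← e₁, ← e₂]
    exact ⟨fun h => by rw [h], fun h => (hK c _).unique h rfl⟩
  have hev := (key _ (equalizer.ι t₁ t₂)).1 (equalizer.condition t₁ t₂)
  refine ⟨⟨equalizer t₁ t₂, homMk (M := act (equalizer t₁ t₂) M) (equalizer.ι t₁ t₂ ▷ M.X ≫ ε)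
    ((Category.assoc _ _ _).trans hev), fun c f => ?_⟩⟩
  obtain ⟨f₀, hf₀⟩ : ∃ f₀ : c ⊗ M.X ⟶ N.X, f₀ = f.hom := ⟨_, rfl⟩
  obtain ⟨g, hg, hu⟩ := hH c f₀
  have hf : ((α_ c M.X A.X).hom ≫ c ◁ M.actRight) ≫ f₀ = f₀ ▷ A.X ≫ N.actRight := by
    rw [hf₀]; exact f.right_act_hom
  refine ⟨equalizer.lift g ((key c g).2 ?_), ?_, fun g' hg' => ?_⟩
  · rw [hg, ← hf, Category.assoc]
  · apply Bimod.hom_ext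
    refine Eq.trans ?_ hf₀
    change equalizer.lift g _ ▷ M.X ≫ equalizer.ι t₁ t₂ ▷ M.X ≫ ε = f₀
    rw [← comp_whiskerRight_assoc, equalizer.lift_ι, hg]
  · have hg'' : g' ▷ M.X ≫ equalizer.ι t₁ t₂ ▷ M.X ≫ ε = f₀ :=
      (congrArg (fun t => t.hom) hg').trans hf₀.symm
    apply equalizer.hom_ext
    rw [equalizer.lift_ι]
    refine hu _ ?_
    change (g' ≫ equalizer.ι t₁ t₂) ▷ M.X ≫ ε = f₀
    rw [comp_whiskerRight, Category.assoc, hg'']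

instance [RigidCategory C] [HasEqualizers C] {A : Mon C} : HasInternalHoms C (RMod A) :=
  ⟨nonempty_internalHom⟩

end RMod

end ModuleHoms

section Induction

open scoped MonoidalLeftAction MonObj

variable {C : Type u} [Category.{v} C] [MonoidalCategory C] [HasCoequalizers C]

section TensorAPI

variable {R S T U : Mon C} (P : Bimod R S) (Q : Bimod S T)

variable [∀ X : C, PreservesColimitsOfSize.{0, 0} (tensorLeft X)]
variable [∀ X : C, PreservesColimitsOfSize.{0, 0} (tensorRight X)]

/-- The projection from the tensor product in `C` to the relative tensor product. -/
noncomputable def relπ : P.X ⊗ Q.X ⟶ (P.tensorBimod Q).X :=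
  coequalizer.π (P.actRight ▷ Q.X) ((α_ _ _ _).hom ≫ (P.X ◁ Q.actLeft))

theorem relπ_condition : P.actRight ▷ Q.X ≫ relπ P Q =
    (α_ _ _ _).hom ≫ P.X ◁ Q.actLeft ≫ relπ P Q :=
  (coequalizer.condition (P.actRight ▷ Q.X) ((α_ _ _ _).hom ≫ (P.X ◁ Q.actLeft))).trans
    (Category.assoc _ _ _)

variable {P Q} in
/-- A morphism from the relative tensor product. -/
noncomputable def relDesc {W : C} (f : P.X ⊗ Q.X ⟶ W)
    (hf : P.actRight ▷ Q.X ≫ f = (α_ _ _ _).hom ≫ P.X ◁ Q.actLeft ≫ f) :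
    (P.tensorBimod Q).X ⟶ W :=
  coequalizer.desc f (hf.trans (Category.assoc _ _ _).symm)

variable {P Q} in
theorem relπ_desc {W : C} (f : P.X ⊗ Q.X ⟶ W)
    (hf : P.actRight ▷ Q.X ≫ f = (α_ _ _ _).hom ≫ P.X ◁ Q.actLeft ≫ f) :
    relπ P Q ≫ relDesc f hf = f := coequalizer.π_desc _ _

instance relπ_epi : Epi (relπ P Q) := inferInstanceAs (Epi (coequalizer.π _ _))

instance relπ_epi_left (c : C) : Epi (c ◁ relπ P Q) :=
  inferInstanceAs (Epi ((tensorLeft c).map (relπ P Q)))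

instance relπ_epi_right (c : C) : Epi (relπ P Q ▷ c) :=
  inferInstanceAs (Epi ((tensorRight c).map (relπ P Q)))

variable {P Q} in
theorem exists_relDesc_left {W c : C} (f : c ⊗ (P.X ⊗ Q.X) ⟶ W)
    (hf : c ◁ (P.actRight ▷ Q.X) ≫ f = c ◁ (α_ _ _ _).hom ≫ c ◁ (P.X ◁ Q.actLeft) ≫ f) :
    ∃ g : c ⊗ (P.tensorBimod Q).X ⟶ W, c ◁ relπ P Q ≫ g = f :=
  ⟨_, id_tensor_π_preserves_coequalizer_inv_desc (P.actRight ▷ Q.X)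
    ((α_ _ _ _).hom ≫ (P.X ◁ Q.actLeft)) f (by
      rw [hf, MonoidalCategory.whiskerLeft_comp, Category.assoc])⟩

theorem relπ_actRight : relπ P Q ▷ T.X ≫ (P.tensorBimod Q).actRight =
    (α_ _ _ _).hom ≫ P.X ◁ Q.actRight ≫ relπ P Q :=
  Bimod.TensorBimod.π_tensor_id_actRight P Q

variable {P} in
theorem relπ_whiskerRight {P' : Bimod R S} (f : P ⟶ P') :
    relπ P Q ≫ (Bimod.whiskerRight f Q).hom = f.hom ▷ Q.X ≫ relπ P' Q :=
  ι_colimMap (parallelPairHom _ _ _ _ (f.hom ▷ _ ▷ _) (f.hom ▷ _) _ _) WalkingParallelPair.one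

theorem relπ_associator (K : Bimod T U) :
    relπ P Q ▷ K.X ≫ relπ (P.tensorBimod Q) K ≫ (Bimod.associatorBimod P Q K).hom.hom =
      (α_ _ _ _).hom ≫ P.X ◁ relπ Q K ≫ relπ P (Q.tensorBimod K) := by
  have h : relπ (P.tensorBimod Q) K ≫ (Bimod.associatorBimod P Q K).hom.hom =
      Bimod.AssociatorBimod.homAux P Q K := coequalizer.π_desc _ _
  rw [h]
  exact π_tensor_id_preserves_coequalizer_inv_desc _ _ _ _

end TensorAPI

variable [∀ X : C, PreservesColimitsOfSize.{0, 0} (tensorLeft X)]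
variable [∀ X : C, PreservesColimitsOfSize.{0, 0} (tensorRight X)]
variable {A B D : Mon C} (X : Bimod A B)

/-- The functor `- ⊗_A X` from right `A`-modules to right `B`-modules. -/
noncomputable def induct : RMod A ⥤ RMod B where
  obj M := M.tensorBimod X
  map f := Bimod.whiskerRight f X
  map_id _ := Bimod.id_whiskerRight_bimod
  map_comp f g := Bimod.comp_whiskerRight_bimod f g X

theorem relπ_induct_map {M N : RMod A} (f : M ⟶ N) :
    relπ M X ≫ ((induct X).map f).hom = f.hom ▷ X.X ≫ relπ N X :=
  relπ_whiskerRight X f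

/-- The projection `M ⊗ X ⟶ M ⊗_A X`. -/
noncomputable def indπ (M : RMod A) : M.X ⊗ X.X ⟶ ((induct X).obj M).X := relπ M X

instance indπ_epi (M : RMod A) : Epi (indπ X M) := relπ_epi M X

instance indπ_epi_left (c : C) (M : RMod A) : Epi (c ◁ indπ X M) := relπ_epi_left M X c

instance indπ_epi_right (c : C) (M : RMod A) : Epi (indπ X M ▷ c) := relπ_epi_right M X c

instance indπ_epi_left_right (c d : C) (M : RMod A) : Epi ((c ◁ indπ X M) ▷ d) :=
  inferInstanceAs (Epi ((tensorRight d).map (c ◁ indπ X M)))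

/-- The projection `(c ⊗ M) ⊗ X ⟶ (c ⊗ M) ⊗_A X`. -/
noncomputable def actπ (c : C) (M : RMod A) :
    (c ⊗ M.X) ⊗ X.X ⟶ ((induct X).obj (c ⊙ₗ M)).X := relπ (c ⊙ₗ M : RMod A) X

theorem actπ_condition (c : C) (M : RMod A) :
    (α_ c M.X A.X).hom ▷ X.X ≫ (c ◁ M.actRight) ▷ X.X ≫ actπ X c M =
      (α_ (c ⊗ M.X) A.X X.X).hom ≫ (c ⊗ M.X) ◁ X.actLeft ≫ actπ X c M := by
  have h := relπ_condition (c ⊙ₗ M : RMod A) X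
  change ((α_ c M.X A.X).hom ≫ c ◁ M.actRight) ▷ X.X ≫ actπ X c M = (α_ (c ⊗ M.X) A.X X.X).hom ≫
    (c ⊗ M.X) ◁ X.actLeft ≫ actπ X c M at h
  rwa [comp_whiskerRight, Category.assoc] at h

theorem actπ_actRight (c : C) (M : RMod A) :
    actπ X c M ▷ B.X ≫ ((induct X).obj (c ⊙ₗ M)).actRight =
      (α_ (c ⊗ M.X) X.X B.X).hom ≫ (c ⊗ M.X) ◁ X.actRight ≫ actπ X c M :=
  relπ_actRight (c ⊙ₗ M : RMod A) X

theorem indπ_actRight (M : RMod A) : indπ X M ▷ B.X ≫ ((induct X).obj M).actRight =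
    (α_ M.X X.X B.X).hom ≫ M.X ◁ X.actRight ≫ indπ X M :=
  relπ_actRight M X

instance actπ_epi (c : C) (M : RMod A) : Epi (actπ X c M) := relπ_epi (c ⊙ₗ M : RMod A) X

instance actπ_epi_right (c d : C) (M : RMod A) : Epi (actπ X c M ▷ d) :=
  relπ_epi_right (c ⊙ₗ M : RMod A) X d

theorem exists_induct_mu (c : C) (M : RMod A) :
    ∃ g : c ⊗ ((induct X).obj M).X ⟶ ((induct X).obj (c ⊙ₗ M)).X,
      c ◁ indπ X M ≫ g = (α_ c M.X X.X).inv ≫ actπ X c M := by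
  refine exists_relDesc_left _ ?_
  have h := actπ_condition X c M
  have h1 : c ◁ (M.actRight ▷ X.X) ≫ (α_ c M.X X.X).inv =
      (α_ c (M.X ⊗ A.X) X.X).inv ≫ (c ◁ M.actRight) ▷ X.X := by simp
  have h2 : (α_ c (M.X ⊗ A.X) X.X).inv = c ◁ (α_ _ _ _).hom ≫ (α_ c M.X (A.X ⊗ X.X)).inv ≫
      (α_ (c ⊗ M.X) A.X X.X).inv ≫ (α_ c M.X A.X).hom ▷ X.X := by simp
  rw [reassoc_of% h1, h2]
  simp only [Category.assoc]
  rw [h]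
  simp

/-- The underlying morphism of the structure morphism of `- ⊗_A X`. -/
noncomputable def muC (c : C) (M : RMod A) :
    c ⊗ ((induct X).obj M).X ⟶ ((induct X).obj (c ⊙ₗ M)).X := (exists_induct_mu X c M).choose

theorem indπ_muC (c : C) (M : RMod A) :
    c ◁ indπ X M ≫ muC X c M = (α_ c M.X X.X).inv ≫ actπ X c M :=
  (exists_induct_mu X c M).choose_spec

/-- The structure morphism `c ⊗ (M ⊗_A X) ⟶ (c ⊗ M) ⊗_A X`. -/
noncomputable def inductMu (c : C) (M : RMod A) :
    c ⊙ₗ (induct X).obj M ⟶ (induct X).obj (c ⊙ₗ M) :=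
  RMod.homMk (muC X c M) (by
    have hg := indπ_muC X c M
    generalize muC X c M = g at hg
    change ((α_ c ((induct X).obj M).X B.X).hom ≫ c ◁ ((induct X).obj M).actRight) ≫ g =
      g ▷ B.X ≫ _
    rw [← cancel_epi ((c ◁ indπ X M) ▷ B.X)]
    have h1 := indπ_actRight X M
    have h2 := actπ_actRight X c M
    have h3 : (c ◁ indπ X M) ▷ B.X ≫ (α_ c ((induct X).obj M).X B.X).hom =
      (α_ _ _ _).hom ≫ c ◁ indπ X M ▷ B.X := associator_naturality_middle _ _ _
    rw [← comp_whiskerRight_assoc, hg, comp_whiskerRight, Category.assoc, Category.assoc, h2,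
      reassoc_of% h3, ← MonoidalCategory.whiskerLeft_comp_assoc, h1]
    simp only [MonoidalCategory.whiskerLeft_comp, Category.assoc, hg]
    simp)

theorem exists_induct_delta (c : C) (M : RMod A) :
    ∃ g : ((induct X).obj (c ⊙ₗ M)).X ⟶ c ⊗ ((induct X).obj M).X,
      actπ X c M ≫ g = (α_ c M.X X.X).hom ≫ c ◁ indπ X M := by
  refine ⟨relDesc (P := (c ⊙ₗ M : RMod A)) ((α_ c M.X X.X).hom ≫ c ◁ indπ X M) ?_,
    relπ_desc _ _⟩
  change ((α_ c M.X A.X).hom ≫ c ◁ M.actRight) ▷ X.X ≫ (α_ c M.X X.X).hom ≫ c ◁ indπ X M =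
    (α_ (c ⊗ M.X) A.X X.X).hom ≫ (c ⊗ M.X) ◁ X.actLeft ≫ (α_ c M.X X.X).hom ≫ c ◁ indπ X M
  have h : c ◁ M.actRight ▷ X.X ≫ c ◁ indπ X M =
      c ◁ (α_ M.X A.X X.X).hom ≫ c ◁ M.X ◁ X.actLeft ≫ c ◁ indπ X M := by
    simp only [← MonoidalCategory.whiskerLeft_comp]
    exact congrArg (fun t => c ◁ t) (relπ_condition M X)
  have h1 : (c ◁ M.actRight) ▷ X.X ≫ (α_ c M.X X.X).hom =
      (α_ c (M.X ⊗ A.X) X.X).hom ≫ c ◁ M.actRight ▷ X.X := associator_naturality_middle _ _ _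
  rw [comp_whiskerRight, Category.assoc, reassoc_of% h1, h]
  simp

/-- The underlying morphism of the inverse structure morphism of `- ⊗_A X`. -/
noncomputable def deltaC (c : C) (M : RMod A) :
    ((induct X).obj (c ⊙ₗ M)).X ⟶ c ⊗ ((induct X).obj M).X := (exists_induct_delta X c M).choose

theorem actπ_deltaC (c : C) (M : RMod A) :
    actπ X c M ≫ deltaC X c M = (α_ c M.X X.X).hom ≫ c ◁ indπ X M :=
  (exists_induct_delta X c M).choose_spec

/-- The inverse structure morphism `(c ⊗ M) ⊗_A X ⟶ c ⊗ (M ⊗_A X)`. -/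
noncomputable def inductDelta (c : C) (M : RMod A) :
    (induct X).obj (c ⊙ₗ M) ⟶ c ⊙ₗ (induct X).obj M :=
  RMod.homMk (deltaC X c M) (by
    have hg := actπ_deltaC X c M
    generalize deltaC X c M = g at hg
    change _ ≫ g = g ▷ B.X ≫ (α_ c ((induct X).obj M).X B.X).hom ≫ c ◁ ((induct X).obj M).actRight
    rw [← cancel_epi (actπ X c M ▷ B.X)]
    have h1 := indπ_actRight X M
    have h2 := actπ_actRight X c M
    have h3 : (c ◁ indπ X M) ▷ B.X ≫ (α_ c ((induct X).obj M).X B.X).hom =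
      (α_ _ _ _).hom ≫ c ◁ indπ X M ▷ B.X := associator_naturality_middle _ _ _
    rw [reassoc_of% h2, hg, ← comp_whiskerRight_assoc, hg, comp_whiskerRight, Category.assoc,
      reassoc_of% h3, ← MonoidalCategory.whiskerLeft_comp, h1]
    simp)

theorem indπ_map {M N : RMod A} (f : M ⟶ N) :
    indπ X M ≫ ((induct X).map f).hom = f.hom ▷ X.X ≫ indπ X N :=
  relπ_whiskerRight X f

theorem actπ_map_right (c : C) {M N : RMod A} (f : M ⟶ N) :
    actπ X c M ≫ ((induct X).map (c ⊴ₗ f)).hom = (c ◁ f.hom) ▷ X.X ≫ actπ X c N :=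
  relπ_whiskerRight X (c ⊴ₗ f)

theorem actπ_map_left {c d : C} (f : c ⟶ d) (M : RMod A) :
    actπ X c M ≫ ((induct X).map (f ⊵ₗ M)).hom = (f ▷ M.X) ▷ X.X ≫ actπ X d M :=
  relπ_whiskerRight X (f ⊵ₗ M)

theorem actπ_map_unit (M : RMod A) :
    actπ X (𝟙_ C) M ≫ ((induct X).map (MonoidalLeftAction.actionUnitIso M).hom).hom =
      (λ_ M.X).hom ▷ X.X ≫ indπ X M :=
  relπ_whiskerRight X (MonoidalLeftAction.actionUnitIso M : 𝟙_ C ⊙ₗ M ≅ M).hom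

/-- The projection `(c ⊗ (d ⊗ M)) ⊗ X ⟶ (c ⊗ (d ⊗ M)) ⊗_A X`. -/
noncomputable def actπ₂ (c d : C) (M : RMod A) :
    (c ⊗ d ⊗ M.X) ⊗ X.X ⟶ ((induct X).obj (c ⊙ₗ d ⊙ₗ M)).X := actπ X c (d ⊙ₗ M : RMod A)

theorem actπ_map_assoc (c d : C) (M : RMod A) :
    actπ X (c ⊗ d) M ≫ ((induct X).map (MonoidalLeftAction.actionAssocIso c d M).hom).hom =
      (α_ c d M.X).hom ▷ X.X ≫ actπ₂ X c d M :=
  relπ_whiskerRight X (MonoidalLeftAction.actionAssocIso c d M).hom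

theorem actπ_muC (c d : C) (M : RMod A) :
    c ◁ actπ X d M ≫ muC X c (d ⊙ₗ M) = (α_ c (d ⊗ M.X) X.X).inv ≫ actπ₂ X c d M :=
  indπ_muC X c (d ⊙ₗ M)

/-- The functor `- ⊗_A X` is a module functor. -/
noncomputable instance inductLeftLinear : (induct X).LeftLinear C where
  μₗ c M := inductMu X c M
  δₗ c M := inductDelta X c M
  μₗ_naturality_left {c d} f M := Bimod.hom_ext _ _ (by
    change (f ▷ ((induct X).obj M).X) ≫ muC X d M =
      muC X c M ≫ ((induct X).map (f ⊵ₗ M)).hom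
    rw [← cancel_epi (c ◁ indπ X M), whisker_exchange_assoc, indπ_muC,
      reassoc_of% indπ_muC X c M, actπ_map_left]
    simp)
  μₗ_naturality_right c {M N} f := Bimod.hom_ext _ _ (by
    change c ◁ ((induct X).map f).hom ≫ muC X c N =
      muC X c M ≫ ((induct X).map (c ⊴ₗ f)).hom
    rw [← cancel_epi (c ◁ indπ X M), ← MonoidalCategory.whiskerLeft_comp_assoc, indπ_map,
      reassoc_of% indπ_muC X c M, actπ_map_right, MonoidalCategory.whiskerLeft_comp,
      Category.assoc, indπ_muC]
    simp)
  μₗ_associativity c d M := Bimod.hom_ext _ _ (by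
    change muC X (c ⊗ d) M ≫
        ((induct X).map (MonoidalLeftAction.actionAssocIso c d M).hom).hom =
      (α_ c d ((induct X).obj M).X).hom ≫ c ◁ muC X d M ≫
        muC X c (d ⊙ₗ M)
    rw [← cancel_epi ((c ⊗ d) ◁ indπ X M), reassoc_of% indπ_muC X (c ⊗ d) M,
      actπ_map_assoc, associator_naturality_right_assoc,
      ← MonoidalCategory.whiskerLeft_comp_assoc, indπ_muC,
      MonoidalCategory.whiskerLeft_comp, Category.assoc, actπ_muC]
    simp)
  μₗ_unitality M := Bimod.hom_ext _ _ (by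
    change (λ_ ((induct X).obj M).X).hom = muC X (𝟙_ C) M ≫
      ((induct X).map (MonoidalLeftAction.actionUnitIso M).hom).hom
    rw [← cancel_epi (𝟙_ C ◁ indπ X M), reassoc_of% indπ_muC X (𝟙_ C) M, actπ_map_unit]
    simp)
  δₗ_naturality_left {c d} f M := Bimod.hom_ext _ _ (by
    change ((induct X).map (f ⊵ₗ M)).hom ≫ deltaC X d M =
      deltaC X c M ≫ (f ▷ ((induct X).obj M).X)
    rw [← cancel_epi (actπ X c M), reassoc_of% actπ_map_left X f M, actπ_deltaC,
      reassoc_of% actπ_deltaC X c M, whisker_exchange]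
    simp)
  δₗ_naturality_right c {M N} f := Bimod.hom_ext _ _ (by
    change ((induct X).map (c ⊴ₗ f)).hom ≫ deltaC X c N =
      deltaC X c M ≫ c ◁ ((induct X).map f).hom
    rw [← cancel_epi (actπ X c M), reassoc_of% actπ_map_right X c f, actπ_deltaC,
      reassoc_of% actπ_deltaC X c M, ← MonoidalCategory.whiskerLeft_comp, indπ_map]
    simp)
  δₗ_associativity c d M := Bimod.hom_ext _ _ (by
    change deltaC X (c ⊗ d) M ≫ (α_ c d ((induct X).obj M).X).hom =
      ((induct X).map (MonoidalLeftAction.actionAssocIso c d M).hom).hom ≫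
        deltaC X c (d ⊙ₗ M) ≫ c ◁ deltaC X d M
    have h : actπ₂ X c d M ≫ deltaC X c (d ⊙ₗ M) =
      (α_ c (d ⊗ M.X) X.X).hom ≫ c ◁ actπ X d M := actπ_deltaC X c (d ⊙ₗ M)
    rw [← cancel_epi (actπ X (c ⊗ d) M), reassoc_of% actπ_deltaC X (c ⊗ d) M,
      reassoc_of% actπ_map_assoc X c d M, reassoc_of% h, ← MonoidalCategory.whiskerLeft_comp,
      actπ_deltaC]
    simp)
  δₗ_unitality_inv M := Bimod.hom_ext _ _ (by
    change (λ_ ((induct X).obj M).X).inv =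
      ((induct X).map (MonoidalLeftAction.actionUnitIso M).inv).hom ≫
        deltaC X (𝟙_ C) M
    have h : indπ X M ≫ ((induct X).map
      (MonoidalLeftAction.actionUnitIso M : 𝟙_ C ⊙ₗ M ≅ M).inv).hom =
        (λ_ M.X).inv ▷ X.X ≫ actπ X (𝟙_ C) M := indπ_map X _
    rw [← cancel_epi (indπ X M), reassoc_of% h, actπ_deltaC]
    simp)
  μₗ_comp_δₗ c M := Bimod.hom_ext _ _ (by
    change muC X c M ≫ deltaC X c M = 𝟙 _
    rw [← cancel_epi (c ◁ indπ X M), reassoc_of% indπ_muC X c M, actπ_deltaC]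
    simp)
  δₗ_comp_μₗ c M := Bimod.hom_ext _ _ (by
    change deltaC X c M ≫ muC X c M = 𝟙 _
    rw [← cancel_epi (actπ X c M), reassoc_of% actπ_deltaC X c M, indπ_muC]
    simp)

end Induction

section Composition

open scoped MonoidalLeftAction MonObj

variable {C : Type u} [Category.{v} C] [MonoidalCategory C] [HasCoequalizers C]
variable [∀ X : C, PreservesColimitsOfSize.{0, 0} (tensorLeft X)]
variable [∀ X : C, PreservesColimitsOfSize.{0, 0} (tensorRight X)]
variable {A B D : Mon C} (X : Bimod A B) (Y : Bimod B D)

/-- The natural isomorphism `(- ⊗_A X) ⊗_B Y ≅ - ⊗_A (X ⊗_B Y)`. -/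
noncomputable def inductComp : induct X ⋙ induct Y ≅ induct (X.tensorBimod Y) :=
  NatIso.ofComponents (fun M => Bimod.associatorBimod M X Y) (fun {M N} f => by
    change Bimod.whiskerRight (Bimod.whiskerRight f X) Y ≫ (Bimod.associatorBimod N X Y).hom =
      (Bimod.associatorBimod M X Y).hom ≫ Bimod.whiskerRight f (X.tensorBimod Y)
    rw [Bimod.whiskerRight_comp_bimod]
    simp)

theorem indπ_inductComp (M : RMod A) :
    indπ X M ▷ Y.X ≫ indπ Y ((induct X).obj M) ≫ ((inductComp X Y).hom.app M).hom =
      (α_ M.X X.X Y.X).hom ≫ M.X ◁ relπ X Y ≫ indπ (X.tensorBimod Y) M :=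
  relπ_associator M X Y

theorem actπ_inductComp (c : C) (M : RMod A) :
    actπ X c M ▷ Y.X ≫ indπ Y ((induct X).obj (c ⊙ₗ M)) ≫
        ((inductComp X Y).hom.app (c ⊙ₗ M)).hom =
      (α_ (c ⊗ M.X) X.X Y.X).hom ≫ (c ⊗ M.X) ◁ relπ X Y ≫ actπ (X.tensorBimod Y) c M :=
  relπ_associator (c ⊙ₗ M : RMod A) X Y

theorem inductComp_isModNat : IsModNat C (inductComp X Y).hom := by
  intro c M
  apply Bimod.hom_ext
  change (muC Y c ((induct X).obj M) ≫ ((induct Y).map (inductMu X c M)).hom) ≫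
    ((inductComp X Y).hom.app (c ⊙ₗ M)).hom =
      c ◁ ((inductComp X Y).hom.app M).hom ≫ muC (X.tensorBimod Y) c M
  have h1 : actπ Y c ((induct X).obj M) ≫ ((induct Y).map (inductMu X c M)).hom =
      muC X c M ▷ Y.X ≫ indπ Y ((induct X).obj (c ⊙ₗ M)) := indπ_map Y (inductMu X c M)
  have h2 := congrArg (fun t => c ◁ t) (indπ_inductComp X Y M)
  simp only [MonoidalCategory.whiskerLeft_comp] at h2
  have h3 : (c ◁ indπ X M) ▷ Y.X ≫ muC X c M ▷ Y.X =
      (α_ c M.X X.X).inv ▷ Y.X ≫ actπ X c M ▷ Y.X := by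
    rw [← comp_whiskerRight, indπ_muC, comp_whiskerRight]
  have h4 := indπ_muC Y c ((induct X).obj M)
  have e : Epi (c ◁ (indπ X M ▷ Y.X)) :=
    inferInstanceAs (Epi ((tensorLeft c).map (indπ X M ▷ Y.X)))
  rw [← cancel_epi (c ◁ indπ Y ((induct X).obj M)), ← cancel_epi (c ◁ (indπ X M ▷ Y.X)),
    Category.assoc, reassoc_of% h4, reassoc_of% h1, reassoc_of% h2,
    associator_inv_naturality_middle_assoc, reassoc_of% h3, actπ_inductComp, indπ_muC]
  simp

end Composition

section LinearModules

open scoped MonoidalLeftAction MonObj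

variable {C : Type u} [Category.{v} C] [MonoidalCategory C] [Preadditive C]
  [MonoidalPreadditive C] {A B : Mon C}

namespace RMod

theorem hom_injective (M N : RMod A) :
    Function.Injective (fun f : M ⟶ N => (f.hom : M.X ⟶ N.X)) :=
  fun _ _ h => Bimod.hom_ext _ _ h

variable (M N : RMod A)

instance : Zero (M ⟶ N) := ⟨homMk 0 (by simp)⟩
instance : Add (M ⟶ N) := ⟨fun f g => homMk (f.hom + g.hom) (by
  rw [Preadditive.comp_add, f.right_act_hom, g.right_act_hom, MonoidalPreadditive.add_whiskerRight,
    Preadditive.add_comp])⟩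
instance : Neg (M ⟶ N) := ⟨fun f => homMk (-f.hom) (by
  have h : (-f.hom) ▷ A.X = -(f.hom ▷ A.X) :=
    ((tensorRight A.X).map_neg (f := f.hom) :)
  rw [Preadditive.comp_neg, f.right_act_hom, h, Preadditive.neg_comp])⟩
instance : Sub (M ⟶ N) := ⟨fun f g => homMk (f.hom - g.hom) (by
  have h : (f.hom - g.hom) ▷ A.X = f.hom ▷ A.X - g.hom ▷ A.X :=
    ((tensorRight A.X).map_sub (f := f.hom) (g := g.hom) :)
  rw [Preadditive.comp_sub, f.right_act_hom, g.right_act_hom, h, Preadditive.sub_comp])⟩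
instance : SMul ℕ (M ⟶ N) := ⟨fun n f => homMk (n • f.hom) (by
  have h : (n • f.hom) ▷ A.X = n • (f.hom ▷ A.X) :=
    ((tensorRight A.X).map_nsmul (f := f.hom) (n := n) :)
  rw [Preadditive.comp_nsmul, f.right_act_hom, h, Preadditive.nsmul_comp])⟩
instance : SMul ℤ (M ⟶ N) := ⟨fun n f => homMk (n • f.hom) (by
  have h : (n • f.hom) ▷ A.X = n • (f.hom ▷ A.X) :=
    ((tensorRight A.X).map_zsmul (f := f.hom) (r := n) :)
  rw [Preadditive.comp_zsmul, f.right_act_hom, h, Preadditive.zsmul_comp])⟩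

/-- Right modules form a preadditive category. -/
instance : Preadditive (RMod A) where
  homGroup M N := (hom_injective M N).addCommGroup _ rfl (fun _ _ => rfl) (fun _ => rfl)
    (fun _ _ => rfl) (fun _ _ => rfl) (fun _ _ => rfl)
  add_comp M N K f f' g := Bimod.hom_ext _ _ (Preadditive.add_comp _ _ _ f.hom f'.hom g.hom)
  comp_add M N K f g g' := Bimod.hom_ext _ _ (Preadditive.comp_add _ _ _ f.hom g.hom g'.hom)

theorem add_hom {M N : RMod A} (f g : M ⟶ N) : (f + g).hom = f.hom + g.hom := rfl

/-- The forgetful homomorphism from module morphisms to morphisms. -/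
def homAddHom : (M ⟶ N) →+ (M.X ⟶ N.X) where
  toFun f := f.hom
  map_zero' := rfl
  map_add' _ _ := rfl

theorem sum_hom {M N : RMod A} {J : Type w} (s : Finset J) (f : J → (M ⟶ N)) :
    (∑ i ∈ s, f i).hom = ∑ i ∈ s, (f i).hom := map_sum (homAddHom M N) f s

variable (k : Type w) [Field k] [Linear k C] [MonoidalLinear k C]

instance : SMul k (M ⟶ N) := ⟨fun r f => homMk (r • f.hom) (by
  rw [Linear.comp_smul, f.right_act_hom, MonoidalLinear.smul_whiskerRight, Linear.smul_comp])⟩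

/-- The module structure on module morphisms. -/
instance homModule : Module k (M ⟶ N) :=
  (hom_injective M N).module k (homAddHom M N) (fun _ _ => rfl)

/-- Right modules form a linear category. -/
instance : Linear k (RMod A) where
  homModule M N := homModule M N k
  smul_comp M N K r f g := Bimod.hom_ext _ _ (Linear.smul_comp _ _ _ r f.hom g.hom)
  comp_smul M N K f r g := Bimod.hom_ext _ _ (Linear.comp_smul _ _ _ f.hom r g.hom)

/-- The forgetful linear map from module morphisms to morphisms. -/
def homLinear : (M ⟶ N) →ₗ[k] (M.X ⟶ N.X) where
  toFun f := f.hom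
  map_add' _ _ := rfl
  map_smul' _ _ := rfl

variable {M N}

theorem act_add (c : C) (f g : M ⟶ N) : c ⊴ₗ (f + g) = c ⊴ₗ f + c ⊴ₗ g :=
  Bimod.hom_ext _ _ (MonoidalPreadditive.whiskerLeft_add f.hom g.hom)

theorem act_smul (c : C) (r : k) (f : M ⟶ N) : c ⊴ₗ (r • f) = r • (c ⊴ₗ f) :=
  Bimod.hom_ext _ _ (MonoidalLinear.whiskerLeft_smul c r f.hom)

end RMod

section

variable [HasCoequalizers C] [∀ X : C, PreservesColimitsOfSize.{0, 0} (tensorLeft X)]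
variable [∀ X : C, PreservesColimitsOfSize.{0, 0} (tensorRight X)]
variable (X : Bimod A B)

instance : (induct X).Additive where
  map_add {M N f g} := Bimod.hom_ext _ _ (by
    rw [← cancel_epi (indπ X M), indπ_map, RMod.add_hom, RMod.add_hom, Preadditive.comp_add,
      indπ_map, indπ_map, MonoidalPreadditive.add_whiskerRight, Preadditive.add_comp])

instance (k : Type w) [Field k] [Linear k C] [MonoidalLinear k C] : (induct X).Linear k where
  map_smul {M N} f r := Bimod.hom_ext _ _ (by
    change _ = r • ((induct X).map f).hom
    rw [← cancel_epi (indπ X M), indπ_map]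
    change (r • f.hom) ▷ X.X ≫ _ = _
    rw [Linear.comp_smul,
      indπ_map, MonoidalLinear.smul_whiskerRight, Linear.smul_comp])

end

end LinearModules

section EndExistence

open scoped MonoidalLeftAction MonObj
open MonoidalLeftAction

variable {C : Type u} [Category.{v} C] [MonoidalCategory C] [Preadditive C]
  [MonoidalPreadditive C] [RigidCategory C] [HasEqualizers C] [HasFiniteProducts C]
variable (k : Type w) [Field k] [Linear k C] [MonoidalLinear k C]
variable {A B : Mon C} (F F' : RMod A ⥤ RMod B) [F.Additive] [F'.Additive] [F.Linear k]
  [F'.Linear k]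

theorem RMod.act_sum {M N : RMod A} (c : C) {n : ℕ} (f : Fin n → (M ⟶ N)) :
    c ⊴ₗ (∑ i, f i) = ∑ i, c ⊴ₗ f i := by
  let φ : (M ⟶ N) →+ (c ⊙ₗ M ⟶ c ⊙ₗ N) :=
    AddMonoidHom.mk' (fun f => c ⊴ₗ f) (fun f g => RMod.act_add c f g)
  exact map_sum φ f _

/-- The end of internal Homs exists for linear functors on a category of right modules with a
finite-dimensional generator. -/
theorem exists_end (P : RMod A) {r : ℕ} (b : Fin r → (P ⟶ P))
    (hb : Submodule.span k (Set.range b) = ⊤)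
    (hP : ∀ M : RMod A, ∃ (n : ℕ) (p : Fin n → (M ⟶ P)) (q : Fin n → (P ⟶ M)),
      ∑ i, p i ≫ q i = 𝟙 M) :
    ∃ (E : C) (e : ∀ M, E ⊙ₗ F.obj M ⟶ F'.obj M), IsNatFam E F F' e ∧
      ∀ (c : C) (φ : ∀ M, c ⊙ₗ F.obj M ⟶ F'.obj M), IsNatFam c F F' φ →
        ∃! g : c ⟶ E, ∀ M, g ⊵ₗ F.obj M ≫ e M = φ M := by
  let H : C := iHom C (F.obj P) (F'.obj P)
  let post : (P ⟶ P) → (H ⟶ iHom C (F.obj P) (F'.obj P)) := fun f =>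
    iHomPost C (F.obj P) (F'.map f)
  let pre : (P ⟶ P) → (H ⟶ iHom C (F.obj P) (F'.obj P)) := fun f =>
    iHomPre C (F.map f) (F'.obj P)
  let s : H ⟶ ∏ᶜ fun _ : Fin r => H := Pi.lift fun i => post (b i)
  let t : H ⟶ ∏ᶜ fun _ : Fin r => H := Pi.lift fun i => pre (b i)
  let E : C := equalizer s t
  have key : ∀ (c : C) (g : c ⟶ H) (f : P ⟶ P), g ≫ post f = g ≫ pre f ↔
      c ⊴ₗ F.map f ≫ g ⊵ₗ F.obj P ≫ iEv C _ _ = (g ⊵ₗ F.obj P ≫ iEv C _ _) ≫ F'.map f := by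
    intro c g f
    have h₁ : (g ≫ post f) ⊵ₗ F.obj P ≫ iEv C _ _ = (g ⊵ₗ F.obj P ≫ iEv C _ _) ≫ F'.map f := by
      rw [comp_actionHomLeft, Category.assoc, iHomPost_ev, Category.assoc]
    have h₂ : (g ≫ pre f) ⊵ₗ F.obj P ≫ iEv C _ _ =
        c ⊴ₗ F.map f ≫ g ⊵ₗ F.obj P ≫ iEv C _ _ := by
      rw [comp_actionHomLeft, Category.assoc, iHomPre_ev, action_exchange_assoc]
    rw [← h₁, ← h₂]
    exact ⟨fun h => by rw [h], fun h => iHom_ext h.symm⟩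
  have hι : ∀ i, equalizer.ι s t ≫ post (b i) = equalizer.ι s t ≫ pre (b i) := by
    intro i
    have h := congrArg (fun x => x ≫ Pi.π (fun _ : Fin r => H) i) (equalizer.condition s t)
    simpa [s, t] using h
  let eP : E ⊙ₗ F.obj P ⟶ F'.obj P := equalizer.ι s t ⊵ₗ F.obj P ≫ iEv C _ _
  have natP : ∀ f : P ⟶ P, E ⊴ₗ F.map f ≫ eP = eP ≫ F'.map f := by
    let S : Submodule k (P ⟶ P) :=
      { carrier := {f | E ⊴ₗ F.map f ≫ eP = eP ≫ F'.map f}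
        add_mem' := by
          intro f g hf hg
          simp only [Set.mem_setOf_eq] at hf hg ⊢
          rw [F.map_add, F'.map_add, RMod.act_add, Preadditive.add_comp, Preadditive.comp_add,
            hf, hg]
        zero_mem' := by
          simp only [Set.mem_setOf_eq]
          have h0 : E ⊴ₗ (0 : F.obj P ⟶ F.obj P) = 0 := Bimod.hom_ext _ _
            (MonoidalPreadditive.whiskerLeft_zero)
          rw [F.map_zero, F'.map_zero, h0, zero_comp, comp_zero]
        smul_mem' := by
          intro x f hf
          simp only [Set.mem_setOf_eq] at hf ⊢
          rw [F.map_smul, F'.map_smul, RMod.act_smul, Linear.smul_comp, Linear.comp_smul, hf] }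
    have hS : Submodule.span k (Set.range b) ≤ S := by
      rw [Submodule.span_le]
      rintro _ ⟨i, rfl⟩
      exact (key E (equalizer.ι s t) (b i)).1 (hι i)
    intro f
    exact hS (hb ▸ Submodule.mem_top)
  choose n p q hpq using hP
  let e : ∀ M, E ⊙ₗ F.obj M ⟶ F'.obj M := fun M =>
    ∑ i, E ⊴ₗ F.map (p M i) ≫ eP ≫ F'.map (q M i)
  have h1 : ∀ (M : RMod A) (g : P ⟶ M), E ⊴ₗ F.map g ≫ e M = eP ≫ F'.map g := by
    intro M g
    calc E ⊴ₗ F.map g ≫ e M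
        = ∑ i, E ⊴ₗ F.map (g ≫ p M i) ≫ eP ≫ F'.map (q M i) := by
          simp only [e, Preadditive.comp_sum, F.map_comp, actionHomRight_comp, Category.assoc]
      _ = ∑ i, eP ≫ F'.map (g ≫ p M i ≫ q M i) := by
          refine Finset.sum_congr rfl fun i _ => ?_
          have := natP (g ≫ p M i)
          rw [reassoc_of% this, ← F'.map_comp]
          simp only [eP, Category.assoc]
      _ = eP ≫ F'.map g := by
          rw [← Preadditive.comp_sum, ← Functor.map_sum, ← Preadditive.comp_sum, hpq,
            Category.comp_id]
  have h2 : ∀ (c : C) {M K : RMod A} (f : M ⟶ K), c ⊴ₗ F.map f =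
      ∑ i, c ⊴ₗ F.map (p M i) ≫ c ⊴ₗ F.map (q M i ≫ f) := by
    intro c M K f
    simp only [← actionHomRight_comp, ← F.map_comp]
    rw [← RMod.act_sum, ← Functor.map_sum]
    simp only [← Category.assoc]
    rw [← Preadditive.sum_comp, hpq, Category.id_comp]
  refine ⟨E, e, ?_, ?_⟩
  · intro M K f
    rw [h2 E f, Preadditive.sum_comp]
    simp only [e, Preadditive.sum_comp, Category.assoc, ← F'.map_comp]
    refine Finset.sum_congr rfl fun i _ => ?_
    have := h1 K (q M i ≫ f)
    rw [← this]
  · intro c φ hφ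
    obtain ⟨g₀, hg₀, hu⟩ := iHom_exists_unique (φ P)
    have hcond : g₀ ≫ s = g₀ ≫ t := by
      refine Pi.hom_ext _ _ fun i => ?_
      have := (key c g₀ (b i)).2 (by rw [hg₀]; exact hφ (b i))
      simpa [s, t] using this
    have hlift : (equalizer.lift g₀ hcond : c ⟶ E) ⊵ₗ F.obj P ≫ eP = φ P := by
      simp only [eP]
      rw [← comp_actionHomLeft_assoc, equalizer.lift_ι, hg₀]
    have hid : ∀ M, c ⊴ₗ F.map (𝟙 M) ≫ φ M = φ M := by intro M; simp
    refine ⟨equalizer.lift g₀ hcond, fun M => ?_, fun g' hg' => ?_⟩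
    · rw [← hid M, h2 c (𝟙 M), Preadditive.sum_comp]
      simp only [e, Preadditive.comp_sum, Category.comp_id, Category.assoc]
      refine Finset.sum_congr rfl fun i _ => ?_
      rw [hφ (q M i), ← hlift, ← action_exchange_assoc]
      simp only [eP, Category.assoc]
    · apply equalizer.hom_ext
      rw [equalizer.lift_ι]
      refine hu _ ?_
      have he : e P = eP := by
        have := h1 P (𝟙 P)
        simpa using this
      have := hg' P
      rw [he] at this
      simp only [comp_actionHomLeft, Category.assoc]
      exact this

end EndExistence

section Fusion

open scoped MonoidalLeftAction MonObj ComonObj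
open MonoidalLeftAction

attribute [local instance] Abelian.hasFiniteBiproducts

instance tensorLeft_preservesColimits {C : Type u} [Category.{v} C] [MonoidalCategory C]
    [RigidCategory C] (X : C) : PreservesColimitsOfSize.{0, 0} (tensorLeft X) :=
  (tensorLeftAdjunction (ᘁX) X).leftAdjoint_preservesColimits

instance tensorRight_preservesColimits {C : Type u} [Category.{v} C] [MonoidalCategory C]
    [RigidCategory C] (X : C) : PreservesColimitsOfSize.{0, 0} (tensorRight X) :=
  (tensorRightAdjunction X Xᘁ).leftAdjoint_preservesColimits

/-- A fusion category over `k`: a `k`-linear abelian rigid monoidal category, with bilinear tensor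
product, that has finite-dimensional morphism spaces, simple tensor unit and finitely many
isomorphism classes of simple objects, and in which every object is a finite direct sum of simple
objects. -/
class FusionCategory (k : Type w) [Field k] (C : Type u) [Category.{v} C] [Abelian C] [Linear k C]
    [MonoidalCategory C] [MonoidalPreadditive C] [MonoidalLinear k C] [RigidCategory C] :
    Prop where
  finite_hom : ∀ X Y : C, Module.Finite k (X ⟶ Y)
  simple_unit : Simple (𝟙_ C)
  finite_simples : ∃ (n : ℕ) (S : Fin n → C), (∀ i, Simple (S i)) ∧
    ∀ T : C, Simple T → ∃ i, Nonempty (T ≅ S i)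
  semisimple : ∀ X : C, ∃ (m : ℕ) (T : Fin m → C), (∀ i, Simple (T i)) ∧ Nonempty (X ≅ ⨁ T)

/-- A Frobenius algebra in a monoidal category whose multiplication is left inverse to its
comultiplication. -/
class SeparableFrobenius {C : Type u} [Category.{v} C] [MonoidalCategory C] (A : Mon C)
    extends ComonObj A.X where
  frobenius_left : A.X ◁ Δ[A.X] ≫ (α_ A.X A.X A.X).inv ≫ μ[A.X] ▷ A.X = μ[A.X] ≫ Δ[A.X]
  frobenius_right : Δ[A.X] ▷ A.X ≫ (α_ A.X A.X A.X).hom ≫ A.X ◁ μ[A.X] = μ[A.X] ≫ Δ[A.X]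
  comul_mul : Δ[A.X] ≫ μ[A.X] = 𝟙 A.X

variable {C : Type u} [Category.{v} C] [MonoidalCategory C]

/-- The algebra `A` as a right module over itself. -/
def RMod.reg (A : Mon C) : RMod A :=
  RMod.mk A.X μ[A.X] (MonObj.mul_one A.X) (by
    rw [MonObj.mul_assoc]; simp)

theorem SeparableFrobenius.unit_left (A : Mon C) [SeparableFrobenius A] :
    (ρ_ A.X).inv ≫ A.X ◁ η[A.X] ≫ A.X ◁ Δ[A.X] ≫ (α_ A.X A.X A.X).inv ≫ μ[A.X] ▷ A.X =
      Δ[A.X] := by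
  rw [SeparableFrobenius.frobenius_left, MonObj.mul_one_assoc, Iso.inv_hom_id_assoc]

theorem SeparableFrobenius.unit_right (A : Mon C) [SeparableFrobenius A] :
    (λ_ A.X).inv ≫ η[A.X] ▷ A.X ≫ Δ[A.X] ▷ A.X ≫ (α_ A.X A.X A.X).hom ≫ A.X ◁ μ[A.X] =
      Δ[A.X] := by
  rw [SeparableFrobenius.frobenius_right, MonObj.one_mul_assoc, Iso.inv_hom_id_assoc]

/-- Every right module over a separable Frobenius algebra is a retract of a free one. -/
theorem RMod.exists_retract {A : Mon C} [SeparableFrobenius A] (M : RMod A) :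
    ∃ (s : M ⟶ M.X ⊙ₗ RMod.reg A) (r : M.X ⊙ₗ RMod.reg A ⟶ M), s ≫ r = 𝟙 M := by
  let r : M.X ⊙ₗ RMod.reg A ⟶ M := RMod.homMk (M := M.X ⊙ₗ RMod.reg A) (show M.X ⊗ A.X ⟶ M.X from
    M.actRight) (by
      change ((α_ M.X A.X A.X).hom ≫ M.X ◁ μ[A.X]) ≫ M.actRight = M.actRight ▷ A.X ≫ M.actRight
      rw [Category.assoc, M.right_assoc]; simp)
  let s₀ : M.X ⟶ M.X ⊗ A.X := (ρ_ M.X).inv ≫ M.X ◁ (η[A.X] ≫ Δ[A.X]) ≫ (α_ M.X A.X A.X).inv ≫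
    M.actRight ▷ A.X
  have hs₀ : M.actRight ≫ s₀ = s₀ ▷ A.X ≫ (α_ M.X A.X A.X).hom ≫ M.X ◁ μ[A.X] := by
    have h1 : M.actRight ≫ s₀ = M.X ◁ Δ[A.X] ≫ (α_ M.X A.X A.X).inv ≫ M.actRight ▷ A.X := by
      have e := congrArg (fun t => M.X ◁ t) (SeparableFrobenius.unit_left A)
      have a := congrArg (fun t => t ▷ A.X) M.right_assoc
      simp only [MonoidalCategory.whiskerLeft_comp, comp_whiskerRight] at e a
      calc M.actRight ≫ s₀ = (ρ_ _).inv ≫ (M.X ⊗ A.X) ◁ (η[A.X] ≫ Δ[A.X]) ≫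
            (α_ (M.X ⊗ A.X) A.X A.X).inv ≫ (M.actRight ▷ A.X) ▷ A.X ≫ M.actRight ▷ A.X := by
              simp only [s₀]
              rw [rightUnitor_inv_naturality_assoc, ← whisker_exchange_assoc,
                associator_inv_naturality_left_assoc]
        _ = M.X ◁ (ρ_ _).inv ≫ M.X ◁ A.X ◁ η[A.X] ≫ M.X ◁ A.X ◁ Δ[A.X] ≫
            M.X ◁ (α_ A.X A.X A.X).inv ≫ M.X ◁ μ[A.X] ▷ A.X ≫ (α_ M.X A.X A.X).inv ≫
            M.actRight ▷ A.X := by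
              have h : (M.actRight ▷ A.X) ▷ A.X ≫ M.actRight ▷ A.X =
                (α_ M.X A.X A.X).hom ▷ A.X ≫ (M.X ◁ μ[A.X]) ▷ A.X ≫ M.actRight ▷ A.X := by
                rw [a]; simp
              rw [h]; monoidal
        _ = _ := by rw [← e]; monoidal
    have h2 : s₀ ▷ A.X ≫ (α_ M.X A.X A.X).hom ≫ M.X ◁ μ[A.X] =
        M.X ◁ Δ[A.X] ≫ (α_ M.X A.X A.X).inv ≫ M.actRight ▷ A.X := by
      have e := congrArg (fun t => M.X ◁ t) (SeparableFrobenius.unit_right A)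
      simp only [MonoidalCategory.whiskerLeft_comp, comp_whiskerRight] at e
      calc s₀ ▷ A.X ≫ (α_ M.X A.X A.X).hom ≫ M.X ◁ μ[A.X] =
          (ρ_ M.X).inv ▷ A.X ≫ (M.X ◁ (η[A.X] ≫ Δ[A.X])) ▷ A.X ≫ (α_ M.X A.X A.X).inv ▷ A.X ≫
            (α_ (M.X ⊗ A.X) A.X A.X).hom ≫ M.actRight ▷ (A.X ⊗ A.X) ≫ M.X ◁ μ[A.X] := by
              simp [s₀]
        _ = (ρ_ M.X).inv ▷ A.X ≫ (M.X ◁ (η[A.X] ≫ Δ[A.X])) ▷ A.X ≫ (α_ M.X A.X A.X).inv ▷ A.X ≫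
            (α_ (M.X ⊗ A.X) A.X A.X).hom ≫ (M.X ⊗ A.X) ◁ μ[A.X] ≫ M.actRight ▷ A.X := by
              rw [whisker_exchange]
        _ = _ := by rw [← e]; monoidal
    rw [h1, h2]
  let s : M ⟶ M.X ⊙ₗ RMod.reg A := RMod.homMk (N := M.X ⊙ₗ RMod.reg A) s₀ hs₀
  refine ⟨s, r, Bimod.hom_ext _ _ ?_⟩
  change s₀ ≫ M.actRight = 𝟙 M.X
  have h1 : η[A.X] ≫ Δ[A.X] ≫ μ[A.X] = η[A.X] := by
    rw [SeparableFrobenius.comul_mul, Category.comp_id]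
  simp only [s₀, Category.assoc]
  rw [← M.right_assoc, ← MonoidalCategory.whiskerLeft_comp_assoc, Category.assoc, h1,
    M.actRight_one]
  simp

end Fusion

section Defects

open scoped MonoidalLeftAction MonObj ComonObj
open MonoidalLeftAction

attribute [local instance] Abelian.hasFiniteBiproducts

theorem exists_generator (k : Type w) [Field k] {C : Type u} [Category.{v} C] [Abelian C]
    [Linear k C] [MonoidalCategory C] [MonoidalPreadditive C] [MonoidalLinear k C]
    [RigidCategory C] [FusionCategory k C] (A : Mon C) [SeparableFrobenius A] :
    ∃ P : RMod A, ∀ M : RMod A, ∃ (n : ℕ) (p : Fin n → (M ⟶ P)) (q : Fin n → (P ⟶ M)),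
      ∑ i, p i ≫ q i = 𝟙 M := by
  obtain ⟨n, S, -, hS⟩ := FusionCategory.finite_simples (k := k) (C := C)
  refine ⟨(⨁ S) ⊙ₗ RMod.reg A, fun M => ?_⟩
  obtain ⟨s, r, hsr⟩ := RMod.exists_retract M
  obtain ⟨m, T, hT, ⟨φ⟩⟩ := FusionCategory.semisimple (k := k) M.X
  choose σ hσ using fun i => hS (T i) (hT i)
  let ψ : ∀ i, T i ≅ S (σ i) := fun i => Classical.choice (hσ i)
  let x : Fin m → (M.X ⟶ ⨁ S) := fun i => φ.hom ≫ biproduct.π T i ≫ (ψ i).hom ≫ biproduct.ι S (σ i)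
  let y : Fin m → ((⨁ S) ⟶ M.X) := fun i =>
    biproduct.π S (σ i) ≫ (ψ i).inv ≫ biproduct.ι T i ≫ φ.inv
  have hxy : ∑ i, x i ≫ y i = 𝟙 M.X := by
    have h : ∀ i, x i ≫ y i = φ.hom ≫ (biproduct.π T i ≫ biproduct.ι T i) ≫ φ.inv := by
      intro i; simp [x, y]
    simp only [h]
    rw [← Preadditive.comp_sum, ← Preadditive.sum_comp, biproduct.total]
    simp
  refine ⟨m, fun i => s ≫ x i ⊵ₗ RMod.reg A, fun i => y i ⊵ₗ RMod.reg A ≫ r, ?_⟩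
  have h : ∀ i, (s ≫ x i ⊵ₗ RMod.reg A) ≫ y i ⊵ₗ RMod.reg A ≫ r =
      s ≫ ((x i ≫ y i) ⊵ₗ RMod.reg A) ≫ r := by
    intro i; simp
  simp only [h]
  rw [← Preadditive.comp_sum, ← Preadditive.sum_comp]
  have h2 : ∑ i, (x i ≫ y i) ⊵ₗ RMod.reg A = 𝟙 (M.X ⊙ₗ RMod.reg A) := by
    apply Bimod.hom_ext
    rw [RMod.sum_hom]
    change ∑ i, (x i ≫ y i) ▷ A.X = 𝟙 (M.X ⊗ A.X)
    rw [← sum_whiskerRight, hxy, id_whiskerRight]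
  rw [h2, Category.id_comp, hsr]

theorem nonempty_defectNat (k : Type w) [Field k] {C : Type u} [Category.{v} C] [Abelian C]
    [Linear k C] [MonoidalCategory C] [MonoidalPreadditive C] [MonoidalLinear k C]
    [RigidCategory C] [FusionCategory k C] {A B : Mon C} [SeparableFrobenius A] (X Y : Bimod A B) :
    Nonempty (InternalNat C (induct X) (induct Y)) := by
  obtain ⟨P, hP⟩ := exists_generator k A
  have hfin : Module.Finite k (P.X ⟶ P.X) := FusionCategory.finite_hom P.X P.X
  have hfin' : Module.Finite k (P ⟶ P) :=
    Module.Finite.of_injective (RMod.homLinear P P k) (RMod.hom_injective P P)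
  obtain ⟨r, b, hb⟩ := Module.Finite.exists_fin (R := k) (M := (P ⟶ P))
  obtain ⟨E, e, h1, h2⟩ := exists_end k (induct X) (induct Y) P b hb hP
  exact nonempty_internalNat h1 h2

variable (k : Type w) [Field k] {C : Type u} [Category.{v} C] [Abelian C] [Linear k C]
  [MonoidalCategory C] [MonoidalPreadditive C] [MonoidalLinear k C] [RigidCategory C]
  [FusionCategory k C]

/-- The internal natural transformations from `G^X = - ⊗_A X` to `G^Y = - ⊗_A Y`. -/
noncomputable def defectNat {A B : Mon C} [SeparableFrobenius A] (X Y : Bimod A B) :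
    InternalNat C (induct X) (induct Y) :=
  Classical.choice (nonempty_defectNat k X Y)

/-- The object `D^{X,Y}` of defect fields in the Drinfeld center, for bimodules `X` and `Y`. -/
noncomputable def defectField {A B : Mon C} [SeparableFrobenius A] (X Y : Bimod A B) : Center C :=
  (defectNat k X Y).obj

variable {A A' A'' : Mon C} [SeparableFrobenius A] [SeparableFrobenius A']
  (X₁ X₃ : Bimod A A') (X₂ X₄ : Bimod A' A'')

/-- `D^{X₁ ⊗ X₂, X₃ ⊗ X₄}` as internal natural transformations between composite functors. -/
noncomputable def defectNatComp :
    InternalNat C (induct X₁ ⋙ induct X₂) (induct X₃ ⋙ induct X₄) :=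
  (defectNat k (X₁.tensorBimod X₂) (X₃.tensorBimod X₄)).ofIso
    (inductComp X₁ X₂).symm (inductComp X₃ X₄).symm
    (IsModNat.inv (inductComp_isModNat X₁ X₂)) (IsModNat.inv (inductComp_isModNat X₃ X₄))

/-- The left horizontal operator product of defect fields. -/
noncomputable def muHorLeft :
    defectField k X₂ X₄ ⊗ defectField k X₁ X₃ ⟶
      defectField k (X₁.tensorBimod X₂) (X₃.tensorBimod X₄) :=
  horLeft (defectNat k X₂ X₄) (defectNat k X₁ X₃) (defectNatComp k X₁ X₃ X₂ X₄)

/-- The right horizontal operator product of defect fields. -/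
noncomputable def muHorRight :
    defectField k X₁ X₃ ⊗ defectField k X₂ X₄ ⟶
      defectField k (X₁.tensorBimod X₂) (X₃.tensorBimod X₄) :=
  horRight (defectNat k X₂ X₄) (defectNat k X₁ X₃) (defectNatComp k X₁ X₃ X₂ X₄)

end Defects

end DefectFields

/-!
A morphism into `Nat(G₂G₁, G₄G₃)` is determined by its composites with the structure morphisms of
the end, and a morphism into an internal Hom by its evaluation. Evaluated on `G₂ (G₁ m)`, the left
product is `G₂` of the evaluation of `j₁₃` followed by the evaluation of `j₂₄` at `G₃ m`, the right
product is the evaluation of `j₂₄` at `G₁ m` followed by `G₄` of the evaluation of `j₁₃`. That the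
two agree is naturality of the evaluation of `j₂₄`, along a morphism `c ⊙ G₁ m ⟶ G₃ m` with
`c = Nat(G₁, G₃)` rather than along a morphism `G₁ m ⟶ G₃ m`; moving `Nat(G₂, G₄)` past `c` costs
its half-braiding, because the evaluation of `j₂₄` is a module natural transformation.
-/

namespace DefectFields

section HorizontalExchange

open scoped MonoidalLeftAction
open Functor.LaxLeftLinear MonoidalLeftAction

variable {C : Type u} [Category.{v} C] [MonoidalCategory C]
variable {M : Type u₁} [Category.{v₁} M] [MonoidalLeftAction C M]
variable {N : Type u₂} [Category.{v₂} N] [MonoidalLeftAction C N]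
variable {L : Type u₃} [Category.{v₃} L] [MonoidalLeftAction C L]

theorem IsModFam.halfBraiding_exchange {Z : Center C} {F F' : M ⥤ N} [F.LeftLinear C]
    [F'.LeftLinear C] {φ : ∀ m, Z.1 ⊙ₗ F.obj m ⟶ F'.obj m} (hmod : IsModFam Z F F' φ)
    (hnat : IsNatFam Z.1 F F' φ) {c : C} {m m' : M} (f : c ⊙ₗ m ⟶ m') :
    Z.1 ⊴ₗ (μₗ F c m ≫ F.map f) ≫ φ m' =
      (αₗ Z.1 c (F.obj m)).inv ≫ (Z.2.β c).hom ⊵ₗ F.obj m ≫ (αₗ c Z.1 (F.obj m)).hom ≫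
        c ⊴ₗ φ m ≫ μₗ F' c m ≫ F'.map f :=
  calc Z.1 ⊴ₗ (μₗ F c m ≫ F.map f) ≫ φ m'
      = Z.1 ⊴ₗ μₗ F c m ≫ φ (c ⊙ₗ m) ≫ F'.map f := by
        rw [actionHomRight_comp, Category.assoc, hnat f]
    _ = _ := by
        rw [reassoc_of% hmod c m]

theorem InternalNat.hom_ext [HasInternalHoms C N] {F F' : M ⥤ N} [F.LeftLinear C]
    [F'.LeftLinear C] (I : InternalNat C F F') {c : C} {f g : c ⟶ I.obj.1}
    (h : ∀ m, f ≫ I.j m = g ≫ I.j m) : f = g := by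
  have hdinat : IsDinat c F F' (fun m => g ≫ I.j m) := fun m m' k => by
    simp only [Category.assoc, I.dinat k]
  exact (I.exists_unique c _ hdinat).unique h fun _ => rfl

theorem InternalNat.lift_j [RigidCategory C] [HasInternalHoms C N] {F F' : M ⥤ N}
    [F.LeftLinear C] [F'.LeftLinear C] (I : InternalNat C F F') (Z : Center C)
    (φ : ∀ m, Z.1 ⟶ iHom C (F.obj m) (F'.obj m)) (hd : IsDinat Z.1 F F' φ)
    (hm : IsModFam Z F F' (fun m => φ m ⊵ₗ F.obj m ≫ iEv C _ _)) (m : M) :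
    (I.lift Z φ hd hm).f ≫ I.j m = φ m :=
  (I.exists_unique Z.1 φ hd).choose_spec.1 m

variable [HasInternalHoms C N] [HasInternalHoms C L]
variable {G₁ G₃ : M ⥤ N} {G₂ G₄ : N ⥤ L} [G₁.LeftLinear C] [G₂.LeftLinear C]
  [G₃.LeftLinear C] [G₄.LeftLinear C]
variable (I₂₄ : InternalNat C G₂ G₄) (I₁₃ : InternalNat C G₁ G₃)

theorem horLeftFam_eq_halfBraiding_comp_horRightFam (m : M) :
    horLeftFam I₂₄ I₁₃ m = (I₂₄.obj.2.β I₁₃.obj.1).hom ≫ horRightFam I₂₄ I₁₃ m := by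
  apply iHom_ext
  let ev₁₃ : I₁₃.obj.1 ⊙ₗ G₁.obj m ⟶ G₃.obj m := I₁₃.j m ⊵ₗ G₁.obj m ≫ iEv C _ _
  let ev₂₄ (n : N) : I₂₄.obj.1 ⊙ₗ G₂.obj n ⟶ G₄.obj n := I₂₄.j n ⊵ₗ G₂.obj n ≫ iEv C _ _
  let b := (I₂₄.obj.2.β I₁₃.obj.1).hom
  have exchange := I₂₄.isMod.halfBraiding_exchange ((isDinat_iff _).1 I₂₄.dinat) ev₁₃
  calc horLeftFam I₂₄ I₁₃ m ⊵ₗ G₂.obj (G₁.obj m) ≫ iEv C _ _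
      = (αₗ _ _ _).hom ≫ I₂₄.obj.1 ⊴ₗ (μₗ G₂ _ _ ≫ G₂.map ev₁₃) ≫ ev₂₄ (G₃.obj m) :=
        horLeftFam_ev I₂₄ I₁₃ m
    _ = b ⊵ₗ _ ≫ (αₗ _ _ _).hom ≫ I₁₃.obj.1 ⊴ₗ ev₂₄ (G₁.obj m) ≫ μₗ G₄ _ _ ≫ G₄.map ev₁₃ := by
        rw [exchange, Iso.hom_inv_id_assoc]
    _ = b ⊵ₗ _ ≫ horRightFam I₂₄ I₁₃ m ⊵ₗ _ ≫ iEv C _ _ := by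
        rw [← horRightFam_ev]; rfl
    _ = (b ≫ horRightFam I₂₄ I₁₃ m) ⊵ₗ _ ≫ iEv C _ _ := by
        rw [comp_actionHomLeft, Category.assoc]

theorem horLeft_j [RigidCategory C] (I : InternalNat C (G₁ ⋙ G₂) (G₃ ⋙ G₄)) (m : M) :
    (horLeft I₂₄ I₁₃ I).f ≫ I.j m = horLeftFam I₂₄ I₁₃ m :=
  I.lift_j _ _ (horLeftFam_dinat I₂₄ I₁₃) (horLeftFam_isMod I₂₄ I₁₃) m

theorem horRight_j [RigidCategory C] (I : InternalNat C (G₁ ⋙ G₂) (G₃ ⋙ G₄)) (m : M) :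
    (horRight I₂₄ I₁₃ I).f ≫ I.j m = horRightFam I₂₄ I₁₃ m :=
  I.lift_j _ _ (horRightFam_dinat I₂₄ I₁₃) (horRightFam_isMod I₂₄ I₁₃) m

end HorizontalExchange

end DefectFields

open DefectFields in
theorem mainTheorem5_general {C : Type*} [Category* C] [MonoidalCategory C] [RigidCategory C]
    {M N L : Type*} [Category* M] [Category* N] [Category* L] [MonoidalLeftAction C M]
    [MonoidalLeftAction C N] [MonoidalLeftAction C L] [HasInternalHoms C N] [HasInternalHoms C L]
    {G₁ G₃ : M ⥤ N} {G₂ G₄ : N ⥤ L} [G₁.LeftLinear C] [G₂.LeftLinear C] [G₃.LeftLinear C]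
    [G₄.LeftLinear C] (I₂₄ : InternalNat C G₂ G₄) (I₁₃ : InternalNat C G₁ G₃)
    (I : InternalNat C (G₁ ⋙ G₂) (G₃ ⋙ G₄)) :
    horLeft I₂₄ I₁₃ I = (β_ I₂₄.obj I₁₃.obj).hom ≫ horRight I₂₄ I₁₃ I := by
  refine Center.ext _ _ (I.hom_ext fun m => ?_)
  rw [Center.comp_f, Category.assoc, horLeft_j, horRight_j]
  exact horLeftFam_eq_halfBraiding_comp_horRightFam I₂₄ I₁₃ m

theorem mainTheorem5 {k : Type*} [Field k] [IsAlgClosed k] [CharZero k]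
    {C : Type*} [Category* C] [Abelian C] [Linear k C] [MonoidalCategory C]
    [MonoidalPreadditive C] [MonoidalLinear k C] [RigidCategory C]
    [DefectFields.FusionCategory k C]
    {A A' A'' : Mon C} [DefectFields.SeparableFrobenius A] [DefectFields.SeparableFrobenius A']
    [DefectFields.SeparableFrobenius A'']
    (X₁ X₃ : Bimod A A') (X₂ X₄ : Bimod A' A'') :
    DefectFields.muHorLeft k X₁ X₃ X₂ X₄ =
      (β_ (DefectFields.defectField k X₂ X₄) (DefectFields.defectField k X₁ X₃)).hom ≫
        DefectFields.muHorRight k X₁ X₃ X₂ X₄ :=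
  mainTheorem5_general (DefectFields.defectNat k X₂ X₄) (DefectFields.defectNat k X₁ X₃)
    (DefectFields.defectNatComp k X₁ X₃ X₂ X₄)
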